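/- Let $s\ge 0$ and $d\ge 1$. Write $\hat f$ for the Fourier transform on $\mathcal S'(\mathbb R^d)$ (kernel $e^{-2\pi i x\cdot\xi}$), $f^\vee$ for its inverse, and $\nu_d$ for the volume of the unit ball of $\mathbb R^d$. The spectral Barron space $\mathscr B^s(\mathbb R^d)$ is the space of all $f\in\mathcal S'(\mathbb R^d)$ whose Fourier transform $\hat f$ is a function with $$\|f\|_{\mathscr B^s}:=\int_{\mathbb R^d}(1+|\xi|^s)\,|\hat f(\xi)|\,d\xi<\infty .$$ Fix any smooth dyadic resolution of unity $(\varphi_j)_{j\ge 0}\subset\mathcal S(\mathbb R^d)$: $0\le\varphi_j\le 1$, $\operatorname{supp}\varphi_0\subset\{|x|\le 2\}$, $\operatorname{supp}\varphi_j\subset\{2^{j-1}\le|x|\le 2^{j+1}\}$ for $j\ge 1$, $\sup_{j,x}2^{j|\beta|}|\partial^\beta\varphi_j(x)|<\infty$ for every multi-index $\beta$, and $\sum_{j\ge 0}\varphi_j=1$ on $\mathbb R^d$. For $\alpha\in\mathbb R$ and $1\le p,q\le\infty$, the Besov space $B^\alpha_{p,q}(\mathbb R^d)$ is the space of all $f\in\mathcal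 S'(\mathbb R^d)$ with $$\|f\|_{B^\alpha_{p,q}}:=\Big(\sum_{j\ge 0}2^{\alpha qj}\|(\varphi_j\hat f)^\vee\|_{L^p}^q\Big)^{1/q}<\infty$$ (for $q=\infty$: $\sup_{j\ge 0}2^{\alpha j}\|(\varphi_j\hat f)^\vee\|_{L^p}<\infty$). Write $X\hookrightarrow Y$ if $X\subset Y$ and $\|f\|_Y\le C\|f\|_X$ for all $f\in X$ with a constant $C$ independent of $f$. Then the following hold. (1) $B^{s+d/2}_{2,1}(\mathbb R^d)\hookrightarrow\mathscr B^s(\mathbb R^d)\hookrightarrow B^s_{\infty,1}(\mathbb R^d)$, and, for all $f\in\mathcal S'(\mathbb R^d)$ (a norm being $\infty$ outside its space), $$2^{-s}\|f\|_{B^s_{\infty,1}}\le\|f\|_{\mathscr B^s}\le 2^{s+1+d/2}\sqrt{\nu_d}\,\|f\|_{B^{s+d/2}_{2,1}} .$$ These constants do not blow up with the dimension: $2^{-s}$ does not depend on $d$, and for fixed $s$ one has $2^{s+1+d/2}\sqrt{\nu_d}\to 0$ as $d\to\infty$. (2) The embedding is optimal: for all $\alpha\in\mathbb R$ and $1\le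 p,q\le\infty$, $$B^\alpha_{p,q}(\mathbb R^d)\hookrightarrow\mathscr B^s(\mathbb R^d)\iff B^\alpha_{p,q}(\mathbb R^d)\hookrightarrow B^{s+d/2}_{2,1}(\mathbb R^d),$$ $$\mathscr B^s(\mathbb R^d)\hookrightarrow B^\alpha_{p,q}(\mathbb R^d)\iff B^s_{\infty,1}(\mathbb R^d)\hookrightarrow B^\alpha_{p,q}(\mathbb R^d).$$ -/

import Mathlib

open MeasureTheory Filter Topology FourierTransform
open scoped ENNReal NNReal SchwartzMap

noncomputable section

/-- The `L^p` norm of a tempered distribution on `ℝ^d`: the `L^p` norm of the function representing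
`T` if `T` is given by a function in `L^p` (which is then unique almost everywhere), and `∞`
otherwise. -/
def distLpNorm {d : ℕ} (p : ℝ≥0∞) [Fact (1 ≤ p)]
    (T : 𝓢'(EuclideanSpace ℝ (Fin d), ℂ)) : ℝ≥0∞ :=
  ⨅ (g : Lp ℂ p (volume : Measure (EuclideanSpace ℝ (Fin d))))
    (_ : Lp.toTemperedDistribution g = T), ‖g‖ₑ

/-- The spectral Barron norm `∫ (1 + |ξ|^s) |f̂(ξ)| dξ` of a tempered distribution `f`, where `f̂` is
the distributional Fourier transform (with kernel `e^{-2πi x·ξ}`). For `s ≥ 0` its finiteness forces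
`f̂` to be an `L^1` function; the value is `∞` if `f̂` is not one. The spectral Barron space
`ℬ^s(ℝ^d)` consists of all `f` of finite norm. -/
def barronNorm {d : ℕ} (s : ℝ) (f : 𝓢'(EuclideanSpace ℝ (Fin d), ℂ)) : ℝ≥0∞ :=
  ⨅ (g : Lp ℂ 1 (volume : Measure (EuclideanSpace ℝ (Fin d))))
    (_ : Lp.toTemperedDistribution g = 𝓕 f),
    ∫⁻ ξ, ENNReal.ofReal (1 + ‖ξ‖ ^ s) * ‖g ξ‖ₑ

/-- A smooth dyadic resolution of unity on `ℝ^d`. The derivative bounds are stated for the whole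
`k`-th derivative, which amounts to stating them for all partial derivatives of order `k`. -/
structure IsDyadicResolution {d : ℕ} (φ : ℕ → 𝓢(EuclideanSpace ℝ (Fin d), ℝ)) : Prop where
  nonneg : ∀ j x, 0 ≤ φ j x
  le_one : ∀ j x, φ j x ≤ 1
  tsupport_zero : tsupport (φ 0) ⊆ {x | ‖x‖ ≤ 2}
  tsupport_pos : ∀ j : ℕ, 1 ≤ j →
    tsupport (φ j) ⊆ {x | (2 : ℝ) ^ (j - 1 : ℝ) ≤ ‖x‖ ∧ ‖x‖ ≤ (2 : ℝ) ^ (j + 1 : ℝ)}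
  deriv_bound : ∀ k : ℕ, ∃ c : ℝ, 0 < c ∧ ∀ (j : ℕ) (x : EuclideanSpace ℝ (Fin d)),
    (2 : ℝ) ^ (j * k) * ‖iteratedFDeriv ℝ k (φ j) x‖ ≤ c
  hasSum_one : ∀ x, HasSum (fun j => φ j x) 1

/-- The dyadic piece `(φ f̂)^∨` of a tempered distribution `f`. -/
def dyadicPiece {d : ℕ} (φ : 𝓢(EuclideanSpace ℝ (Fin d), ℝ))
    (f : 𝓢'(EuclideanSpace ℝ (Fin d), ℂ)) : 𝓢'(EuclideanSpace ℝ (Fin d), ℂ) :=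
  𝓕⁻ (TemperedDistribution.smulLeftCLM ℂ (fun x => ((φ x : ℝ) : ℂ)) (𝓕 f))

/-- The Besov norm of smoothness `α`, integrability `p` and summability `q` of a tempered
distribution, with respect to a dyadic resolution of unity `φ`. The Besov space `B^α_{p,q}(ℝ^d)`
consists of all tempered distributions of finite norm. -/
def besovNorm {d : ℕ} (φ : ℕ → 𝓢(EuclideanSpace ℝ (Fin d), ℝ)) (α : ℝ) (p : ℝ≥0∞) [Fact (1 ≤ p)]
    (q : ℝ≥0∞) (f : 𝓢'(EuclideanSpace ℝ (Fin d), ℂ)) : ℝ≥0∞ :=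
  if q = ∞ then
    ⨆ j : ℕ, ENNReal.ofReal ((2 : ℝ) ^ (α * j)) * distLpNorm p (dyadicPiece (φ j) f)
  else
    (∑' j : ℕ, ENNReal.ofReal ((2 : ℝ) ^ (α * q.toReal * j)) *
      distLpNorm p (dyadicPiece (φ j) f) ^ q.toReal) ^ (1 / q.toReal)

/-- Continuous embedding `X ↪ Y` of the spaces `X = {f | N f < ∞}` and `Y = {f | M f < ∞}` of
tempered distributions, normed by `N` and `M`: `X ⊆ Y`, and the inclusion is bounded. -/
def ContinuouslyEmbeds {d : ℕ} (N M : 𝓢'(EuclideanSpace ℝ (Fin d), ℂ) → ℝ≥0∞) : Prop :=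
  {f | N f < ∞} ⊆ {f | M f < ∞} ∧ ∃ C : ℝ≥0, ∀ f, N f < ∞ → M f ≤ C * N f

/-- The volume of the unit ball of `ℝ^d`. -/
def unitBallVolume (d : ℕ) : ℝ :=
  (volume : Measure (EuclideanSpace ℝ (Fin d))).real (Metric.ball 0 1)

end

/-! Embeddings between spectral Barron spaces and Besov spaces, and their optimality.

Embeddings. If `f̂` is integrable, the `j`-th dyadic piece `(φ_j f̂)^∨` is bounded by `∫ φ_j |f̂|`, and
`2^{sj} φ_j ≤ 2^s (1 + |ξ|^s) φ_j`; summation over `j` gives `besovNorm_top_one_le_barronNorm`.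
Conversely, the Cauchy–Schwarz inequality on the ball of radius `2^{j+1}` and Plancherel's theorem bound
the weighted `L¹` norm of `φ_j f̂` by the `L²` norm of the `j`-th piece, and `f̂` is the sum of the
`φ_j f̂` because compactly supported test functions determine a tempered distribution; this is
`barronNorm_le_besovNorm`.

Optimality. One direction of each equivalence is the transitivity of embeddings. For the other one, it
is shown which exponents an embedding admits.

* If `B^α_{p,q}` embeds into the Barron space of order `s`, then `p ≤ 2`, by testing with chirps
  `e^{-(1+in)|ξ|²} η(ξ)` (`le_two_of_continuouslyEmbeds`), and either `α > s + d/p`, or `α = s + d/p`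
  and `q = 1`, by testing with sums of bumps at the frequencies `2^j`
  (`exponents_of_continuouslyEmbeds`). For these exponents Bernstein's inequality
  (`distLpNorm_two_le_distLpNorm`) shows that `B^α_{p,q}` embeds into `B^{s+d/2}_{2,1}`
  (`continuouslyEmbeds_besovNorm_two_one`).
* If the Barron space embeds into `B^α_{p,q}`, then `p = ∞`, by testing with bumps that concentrate at
  the origin (`eq_top_of_continuouslyEmbeds`), and `α ≤ s`, by testing with a single bump at frequency
  `2^j` (`le_of_continuouslyEmbeds_top`). Then `B^s_{∞,1}` embeds into `B^α_{∞,q}` trivially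
  (`besovNorm_le_besovNorm_one`).

The constant of the first embedding tends to zero as `d → ∞` because `ν_d = π^{d/2} / Γ(d/2 + 1)` decays
faster than any exponential. -/

/-! ### Lebesgue norms -/

/-- Interpolation between `L²` and `L^∞`, the exponents being written so that `r = ∞` is allowed. -/
lemma eLpNorm_le_two_mul_top {α F : Type*} [MeasurableSpace α] {μ : Measure α}
    [NormedAddCommGroup F] (f : α → F) (hf : eLpNorm f ∞ μ ≠ ∞) {r : ℝ≥0∞} (hr : 2 ≤ r) :
    eLpNorm f r μ ≤ eLpNorm f 2 μ ^ (2 * r⁻¹.toReal) * eLpNorm f ∞ μ ^ (1 - 2 * r⁻¹.toReal) := by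
  rcases eq_or_ne r ∞ with rfl | hr'
  · simp
  have hr0 : r ≠ 0 := (lt_of_lt_of_le (by simp) hr).ne'
  have hr2 : 2 ≤ r.toReal := by
    simpa using (ENNReal.toReal_le_toReal (by simp) hr').2 hr
  have hrpos : 0 < r.toReal := by linarith
  rw [eLpNorm_eq_lintegral_rpow_enorm_toReal hr0 hr',
    eLpNorm_eq_lintegral_rpow_enorm_toReal (by simp) (by simp)]
  set M := eLpNorm f ∞ μ with hM
  have hM' : M ^ (r.toReal - 2) ≠ ∞ := ENNReal.rpow_ne_top_of_nonneg (by linarith) hf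
  have key : ∫⁻ x, ‖f x‖ₑ ^ r.toReal ∂μ ≤ (∫⁻ x, ‖f x‖ₑ ^ (2 : ℝ) ∂μ) * M ^ (r.toReal - 2) := by
    rw [← lintegral_mul_const' _ _ hM']
    refine lintegral_mono_ae ?_
    filter_upwards [ae_le_eLpNormEssSup (f := f) (μ := μ)] with x hx
    calc ‖f x‖ₑ ^ r.toReal = ‖f x‖ₑ ^ (2 + (r.toReal - 2)) := by ring_nf
      _ = ‖f x‖ₑ ^ (2 : ℝ) * ‖f x‖ₑ ^ (r.toReal - 2) :=
        ENNReal.rpow_add_of_nonneg _ _ (by norm_num) (by linarith)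
      _ ≤ ‖f x‖ₑ ^ (2 : ℝ) * M ^ (r.toReal - 2) := by
        have hxM : ‖f x‖ₑ ≤ M := by simpa [hM] using hx
        gcongr
  calc (∫⁻ x, ‖f x‖ₑ ^ r.toReal ∂μ) ^ (1 / r.toReal)
      ≤ ((∫⁻ x, ‖f x‖ₑ ^ (2 : ℝ) ∂μ) * M ^ (r.toReal - 2)) ^ (1 / r.toReal) := by gcongr
    _ = _ := by
      rw [ENNReal.mul_rpow_of_nonneg _ _ (by positivity), ← ENNReal.rpow_mul, ← ENNReal.rpow_mul]
      congr 2
      · simp [ENNReal.toReal_inv]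
      · rw [ENNReal.toReal_inv]; field_simp

/-- Scaling of `L^p` norms, the exponent being written so that `p = ∞` is allowed. -/
lemma eLpNorm_comp_smul {E F : Type*} [NormedAddCommGroup E] [NormedSpace ℝ E]
    [FiniteDimensional ℝ E] [MeasurableSpace E] [BorelSpace E] {μ : Measure E} [μ.IsAddHaarMeasure]
    [NormedAddCommGroup F] {f : E → F} (hf : Continuous f)
    {c : ℝ} (hc : 0 < c) (p : ℝ≥0∞) :
    eLpNorm (fun x => f (c • x)) p μ =
      ENNReal.ofReal (c ^ (-(Module.finrank ℝ E * p⁻¹.toReal))) * eLpNorm f p μ := by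
  have hmap := Measure.map_addHaar_smul μ hc.ne'
  have hcd : (0 : ℝ) < (c ^ Module.finrank ℝ E)⁻¹ := by positivity
  have hsm : Measurable (fun x : E => c • x) := measurable_const_smul c
  have h1 : eLpNorm (fun x => f (c • x)) p μ = eLpNorm f p (Measure.map (c • ·) μ) :=
    (eLpNorm_map_measure (f := fun x : E => c • x) hf.aestronglyMeasurable hsm.aemeasurable).symm
  rw [h1, hmap, abs_of_pos hcd, eLpNorm_smul_measure_of_ne_zero (by simpa using hcd),
    ENNReal.ofReal_rpow_of_pos hcd, smul_eq_mul]
  congr 2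
  rw [← Real.rpow_natCast, ← Real.rpow_neg hc.le, ← Real.rpow_mul hc.le]
  simp [one_div]

/-! ### Tempered distributions given by functions -/

section distLpNorm

variable {d : ℕ}

lemma Lp_toTemperedDistribution_injective (p : ℝ≥0∞) [Fact (1 ≤ p)] :
    Function.Injective (fun g : Lp ℂ p (volume : Measure (EuclideanSpace ℝ (Fin d))) =>
      Lp.toTemperedDistribution g) := by
  have h := Lp.ker_toTemperedDistributionCLM_eq_bot (F := ℂ) (p := p)
    (μ := (volume : Measure (EuclideanSpace ℝ (Fin d))))
  exact LinearMap.ker_eq_bot.1 h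

lemma distLpNorm_le {p : ℝ≥0∞} [Fact (1 ≤ p)] {T : 𝓢'(EuclideanSpace ℝ (Fin d), ℂ)}
    {g : Lp ℂ p (volume : Measure (EuclideanSpace ℝ (Fin d)))}
    (hg : Lp.toTemperedDistribution g = T) : distLpNorm p T ≤ ‖g‖ₑ :=
  (iInf_le _ g).trans (iInf_le _ hg)

lemma distLpNorm_toTemperedDistribution (p : ℝ≥0∞) [Fact (1 ≤ p)]
    (g : Lp ℂ p (volume : Measure (EuclideanSpace ℝ (Fin d)))) :
    distLpNorm p (Lp.toTemperedDistribution g) = ‖g‖ₑ := by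
  refine le_antisymm (distLpNorm_le rfl) (le_iInf₂ fun g' hg' => ?_)
  rw [Lp_toTemperedDistribution_injective p hg']

lemma exists_of_distLpNorm_lt_top {p : ℝ≥0∞} [Fact (1 ≤ p)]
    {T : 𝓢'(EuclideanSpace ℝ (Fin d), ℂ)} (h : distLpNorm p T < ∞) :
    ∃ g : Lp ℂ p (volume : Measure (EuclideanSpace ℝ (Fin d))),
      Lp.toTemperedDistribution g = T ∧ distLpNorm p T = ‖g‖ₑ := by
  obtain ⟨g, hg⟩ := iInf_lt_iff.1 h
  obtain ⟨hg, -⟩ := iInf_lt_iff.1 hg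
  exact ⟨g, hg, by rw [← hg, distLpNorm_toTemperedDistribution]⟩

lemma distLpNorm_schwartz (p : ℝ≥0∞) [Fact (1 ≤ p)] (F : 𝓢(EuclideanSpace ℝ (Fin d), ℂ)) :
    distLpNorm p (F : 𝓢'(EuclideanSpace ℝ (Fin d), ℂ)) = eLpNorm F p volume := by
  rw [← Lp.toTemperedDistribution_toLp_eq (p := p), distLpNorm_toTemperedDistribution,
    Lp.enorm_def, eLpNorm_congr_ae (F.coeFn_toLp p volume)]

/-- A distribution that is bounded for the `L²` norm of the test functions is an `L²` function. -/
lemma distLpNorm_two_le_of_bound (T : 𝓢'(EuclideanSpace ℝ (Fin d), ℂ)) (C : ℝ≥0)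
    (hT : ∀ ψ : 𝓢(EuclideanSpace ℝ (Fin d), ℂ), ‖T ψ‖ ≤ C * ‖ψ.toLp 2 volume‖) :
    distLpNorm 2 T ≤ C := by
  let e : 𝓢(EuclideanSpace ℝ (Fin d), ℂ) →ₗ[ℂ]
    Lp ℂ 2 (volume : Measure (EuclideanSpace ℝ (Fin d))) :=
    (SchwartzMap.toLpCLM ℂ ℂ 2 volume).toLinearMap
  have he : DenseRange e := SchwartzMap.denseRange_toLpCLM (by simp)
  let T' : 𝓢(EuclideanSpace ℝ (Fin d), ℂ) →ₗ[ℂ] ℂ := T.toLinearMap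
  let L := LinearMap.extendOfNorm T' e
  have hL : ‖L‖ ≤ C := LinearMap.opNorm_extendOfNorm_le he C.2 hT
  have hLe (ψ) : L (e ψ) = T ψ := LinearMap.extendOfNorm_eq he ⟨C, hT⟩ ψ
  let u := (InnerProductSpace.toDual ℂ _).symm L
  have hu : ‖u‖ ≤ C := by simpa [u] using hL
  have hTu : Lp.toTemperedDistribution (star u) = T := by
    ext ψ
    rw [← hLe ψ, ← InnerProductSpace.toDual_symm_apply (𝕜 := ℂ) (y := L),
      Lp.toTemperedDistribution_apply, L2.inner_def]
    refine integral_congr_ae ?_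
    filter_upwards [Lp.coeFn_star u, ψ.coeFn_toLp 2 volume] with x h1 h2
    have h2' : (e ψ) x = ψ x := h2
    simp only [h1, h2', RCLike.inner_apply, Pi.star_apply, smul_eq_mul]
    rfl
  calc distLpNorm 2 T ≤ ‖star u‖ₑ := distLpNorm_le hTu
    _ ≤ C := by
      have h1 : ‖star u‖ₑ = ‖u‖ₑ := by
        rw [Lp.enorm_def, Lp.enorm_def, eLpNorm_congr_ae (Lp.coeFn_star u)]
        exact eLpNorm_congr_norm_ae (.of_forall fun x => by simp)
      rw [h1, enorm_le_coe]
      exact hu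

lemma norm_toTemperedDistribution_apply_le {p q : ℝ≥0∞} [Fact (1 ≤ p)] [ENNReal.HolderConjugate q p]
    (g : Lp ℂ p (volume : Measure (EuclideanSpace ℝ (Fin d))))
    (ψ : 𝓢(EuclideanSpace ℝ (Fin d), ℂ)) :
    ‖Lp.toTemperedDistribution g ψ‖ₑ ≤ eLpNorm ψ q volume * ‖g‖ₑ := by
  rw [Lp.toTemperedDistribution_apply]
  calc ‖∫ x, ψ x • g x‖ₑ ≤ ∫⁻ x, ‖ψ x • g x‖ₑ := enorm_integral_le_lintegral_enorm _
    _ = eLpNorm ((ψ : _ → ℂ) • (g : _ → ℂ)) 1 volume := by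
      rw [eLpNorm_one_eq_lintegral_enorm]; rfl
    _ ≤ eLpNorm ψ q volume * eLpNorm g p volume :=
      eLpNorm_smul_le_mul_eLpNorm (Lp.aestronglyMeasurable g) ψ.continuous.aestronglyMeasurable
    _ = _ := by rw [Lp.enorm_def]

/-- The inverse Fourier transform maps `L¹` to `L^∞`. -/
lemma distLpNorm_top_fourierInv_le (g : Lp ℂ 1 (volume : Measure (EuclideanSpace ℝ (Fin d)))) :
    distLpNorm ∞ (𝓕⁻ (Lp.toTemperedDistribution g)) ≤ ∫⁻ ξ, ‖g ξ‖ₑ := by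
  have hg : Integrable g volume := L1.integrable_coeFn g
  set h : EuclideanSpace ℝ (Fin d) → ℂ := 𝓕⁻ (g : EuclideanSpace ℝ (Fin d) → ℂ) with hh
  have hinner : Continuous fun p : EuclideanSpace ℝ (Fin d) × EuclideanSpace ℝ (Fin d) =>
      (-innerₗ (EuclideanSpace ℝ (Fin d))) p.1 p.2 := by
    exact (continuous_inner (𝕜 := ℝ) (E := EuclideanSpace ℝ (Fin d))).neg
  have hcont : Continuous h :=
    VectorFourier.fourierIntegral_continuous Real.continuous_fourierChar hinner hg
  have hbd (x) : ‖h x‖ ≤ ∫ ξ, ‖g ξ‖ := by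
    rw [hh, Real.fourierInv_eq]
    exact (norm_integral_le_integral_norm _).trans_eq (by simp)
  have hmem : MemLp h ∞ volume :=
    memLp_top_of_bound hcont.aestronglyMeasurable _ (.of_forall hbd)
  have hT : Lp.toTemperedDistribution (hmem.toLp h) = 𝓕⁻ (Lp.toTemperedDistribution g) := by
    ext ψ
    rw [TemperedDistribution.fourierInv_apply, Lp.toTemperedDistribution_apply,
      Lp.toTemperedDistribution_apply]
    have h1 := VectorFourier.integral_fourierIntegral_smul_eq_flip Real.continuous_fourierChar
      hinner ψ.integrable hg (μ := volume) (ν := volume)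
    have h2 : (-innerₗ (EuclideanSpace ℝ (Fin d))).flip = -innerₗ (EuclideanSpace ℝ (Fin d)) := by
      ext x y; simp [real_inner_comm]
    rw [h2] at h1
    rw [SchwartzMap.fourierInv_coe]
    refine Eq.trans (integral_congr_ae ?_) h1.symm
    filter_upwards [hmem.coeFn_toLp] with x hx
    rw [hx]; rfl
  rw [← hT, distLpNorm_toTemperedDistribution, Lp.enorm_toLp]
  refine eLpNormEssSup_le_of_ae_enorm_bound (.of_forall fun x => ?_)
  rw [hh, Real.fourierInv_eq]
  exact (enorm_integral_le_lintegral_enorm _).trans_eq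
    (lintegral_congr fun v => by rw [enorm_eq_iff_norm_eq, Circle.norm_smul])

end distLpNorm

/-! ### Schwartz functions: products and cut-offs -/

section Schwartz

variable {E : Type*} [NormedAddCommGroup E] [NormedSpace ℝ E]

/-- A multiplier with bounded derivatives acts on the Schwartz seminorms, by Leibniz' rule. -/
lemma norm_iteratedFDeriv_smul_schwartz_le {g : E → ℂ} (hg : ContDiff ℝ (⊤ : ℕ∞) g) (ψ : 𝓢(E, ℂ))
    {n : ℕ} {B : ℝ} (hB : ∀ i ≤ n, ∀ x, ‖iteratedFDeriv ℝ i g x‖ ≤ B) (k : ℕ) (x : E) :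
    ‖x‖ ^ k * ‖iteratedFDeriv ℝ n (fun y => g y * ψ y) x‖ ≤
      B * ∑ i ∈ Finset.range (n + 1), (n.choose i) * SchwartzMap.seminorm ℝ k (n - i) ψ := by
  have h := norm_iteratedFDeriv_mul_le hg (ψ.smooth ⊤) x (n := n) (mod_cast le_top)
  calc ‖x‖ ^ k * ‖iteratedFDeriv ℝ n (fun y => g y * ψ y) x‖
      ≤ ‖x‖ ^ k * ∑ i ∈ Finset.range (n + 1), (n.choose i) * ‖iteratedFDeriv ℝ i g x‖ *
          ‖iteratedFDeriv ℝ (n - i) ψ x‖ := by gcongr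
    _ = ∑ i ∈ Finset.range (n + 1), ‖iteratedFDeriv ℝ i g x‖ * ((n.choose i) *
          (‖x‖ ^ k * ‖iteratedFDeriv ℝ (n - i) ψ x‖)) := by
      rw [Finset.mul_sum]; exact Finset.sum_congr rfl fun i _ => by ring
    _ ≤ ∑ i ∈ Finset.range (n + 1), B * ((n.choose i) * SchwartzMap.seminorm ℝ k (n - i) ψ) := by
      refine Finset.sum_le_sum fun i hi => ?_
      have hi' : i ≤ n := by simpa [Nat.lt_succ_iff] using hi
      have := hB i hi' x
      have := ψ.le_seminorm ℝ k (n - i) x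
      have hB0 : 0 ≤ B := (norm_nonneg _).trans (hB i hi' x)
      gcongr
    _ = _ := by rw [Finset.mul_sum]

variable [FiniteDimensional ℝ E]

/-- A tempered distribution is determined by its values on compactly supported test functions, since
the cut-offs `b(x / (N + 1)) ψ(x)` of a Schwartz function `ψ` converge to `ψ`. -/
lemma temperedDistribution_ext_of_hasCompactSupport {T₁ T₂ : 𝓢'(E, ℂ)}
    (h : ∀ ψ : 𝓢(E, ℂ), HasCompactSupport ψ → T₁ ψ = T₂ ψ) : T₁ = T₂ := by
  ext ψ
  let b : ContDiffBump (0 : E) := ⟨1, 2, one_pos, one_lt_two⟩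
  have hbc : HasCompactSupport (fun x => ((b x : ℝ) : ℂ)) :=
    b.hasCompactSupport.comp_left (g := fun t : ℝ => (t : ℂ)) rfl
  have hbs : ContDiff ℝ (⊤ : ℕ∞) (fun x => ((b x : ℝ) : ℂ)) :=
    Complex.ofRealCLM.contDiff.comp b.contDiff
  let c : 𝓢(E, ℂ) := hbc.toSchwartzMap hbs
  have hc (x) : c x = ((b x : ℝ) : ℂ) := rfl
  let g : ℕ → E → ℂ := fun N x => c (((N : ℝ) + 1)⁻¹ • x)
  have hN (N : ℕ) : (0 : ℝ) < (N : ℝ) + 1 := by positivity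
  have hgs (N) : ContDiff ℝ (⊤ : ℕ∞) (g N) := (c.smooth ⊤).comp (contDiff_const_smul _)
  have hgc (N) : HasCompactSupport (g N) :=
    hbc.comp_homeomorph (Homeomorph.smulOfNeZero ((N : ℝ) + 1)⁻¹ (inv_ne_zero (hN N).ne'))
  have hgt (N) : (g N).HasTemperateGrowth := ((hgc N).toSchwartzMap (hgs N)).hasTemperateGrowth
  let u : ℕ → 𝓢(E, ℂ) := fun N => SchwartzMap.smulLeftCLM ℂ (g N) ψ
  have hu (N x) : u N x = g N x * ψ x := by
    simp [u, SchwartzMap.smulLeftCLM_apply_apply (hgt N)]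
  have hgi (N i : ℕ) (x : E) : ‖iteratedFDeriv ℝ i (g N) x‖ ≤ SchwartzMap.seminorm ℝ 0 i c := by
    have h1 := congrFun (iteratedFDeriv_comp_const_smul (𝕜 := ℝ) (i := i) (f := c) ((N : ℝ) + 1)⁻¹
      ((c.smooth ⊤).of_le (mod_cast le_top))) x
    change ‖iteratedFDeriv ℝ i (fun z => c (((N : ℝ) + 1)⁻¹ • z)) x‖ ≤ _
    rw [h1, norm_smul, norm_pow, norm_inv, Real.norm_of_nonneg (hN N).le]
    refine (mul_le_of_le_one_left (norm_nonneg _) ?_).trans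
      (c.norm_iteratedFDeriv_le_seminorm ℝ i _)
    exact pow_le_one₀ (by positivity) (inv_le_one_of_one_le₀ (by simp))
  have hlim : Tendsto u atTop (𝓝 ψ) := by
    rw [(schwartz_withSeminorms ℝ E ℂ).tendsto_nhds]
    rintro ⟨k, n⟩ ε hε
    set S := ∑ i ∈ Finset.range (n + 1), (n.choose i) * SchwartzMap.seminorm ℝ (k + 1) (n - i) ψ
    set B := 1 + ∑ i ∈ Finset.range (n + 1), SchwartzMap.seminorm ℝ 0 i c with hB
    have hB0 : 0 ≤ B := by positivity
    have hS0 : 0 ≤ S := by positivity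
    -- The difference vanishes for `‖x‖ < N + 1`; elsewhere one spare power of `‖x‖` gives the decay.
    have hbound (N : ℕ) : SchwartzMap.seminorm ℝ k n (u N - ψ) ≤ B * S / ((N : ℝ) + 1) := by
      refine SchwartzMap.seminorm_le_bound ℝ k n _ (by positivity) fun x => ?_
      have hfun : ⇑(u N - ψ) = fun y => (g N y - 1) * ψ y := by
        ext y; simp [hu, sub_mul]
      rw [hfun]
      rcases lt_or_ge ‖x‖ ((N : ℝ) + 1) with hx | hx
      · have hev : (fun y => (g N y - 1) * ψ y) =ᶠ[𝓝 x] fun _ => (0 : ℂ) := by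
          have hopen : {y : E | ‖y‖ < (N : ℝ) + 1} ∈ 𝓝 x :=
            (isOpen_lt continuous_norm continuous_const).mem_nhds hx
          filter_upwards [hopen] with y hy
          have hb1 : b (((N : ℝ) + 1)⁻¹ • y) = 1 := by
            refine b.one_of_mem_closedBall ?_
            rw [mem_closedBall_zero_iff, norm_smul, norm_inv, Real.norm_of_nonneg (hN N).le]
            change ((N : ℝ) + 1)⁻¹ * ‖y‖ ≤ 1
            rw [inv_mul_le_one₀ (hN N)]
            exact le_of_lt hy
          simp [g, hc, hb1]
        rw [(hev.iteratedFDeriv ℝ n).eq_of_nhds]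
        simp only [iteratedFDeriv_fun_zero, Pi.zero_apply, norm_zero, mul_zero]
        positivity
      · have h1 : ∀ i ≤ n, ∀ x, ‖iteratedFDeriv ℝ i (fun y => g N y - 1) x‖ ≤ B := by
          intro i hi x
          have h2 := congrFun (iteratedFDeriv_sub (𝕜 := ℝ) (i := i) (f := g N)
            (g := fun _ => (1 : ℂ)) ((hgs N).of_le (mod_cast le_top)) contDiff_const) x
          change ‖iteratedFDeriv ℝ i (g N - fun _ => (1 : ℂ)) x‖ ≤ B
          rw [h2, Pi.sub_apply]
          refine (norm_sub_le _ _).trans ?_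
          have h3 : ‖iteratedFDeriv ℝ i (fun _ : E => (1 : ℂ)) x‖ ≤ 1 := by
            rcases eq_or_ne i 0 with rfl | hi0
            · simp
            · simp [iteratedFDeriv_const_of_ne hi0]
          have h4 : SchwartzMap.seminorm ℝ 0 i c ≤
              ∑ i ∈ Finset.range (n + 1), SchwartzMap.seminorm ℝ 0 i c :=
            Finset.single_le_sum (f := fun i => SchwartzMap.seminorm ℝ 0 i c)
              (fun _ _ => apply_nonneg _ _) (by simpa [Nat.lt_succ_iff] using hi)
          linarith [hgi N i x]
        have h2 := norm_iteratedFDeriv_smul_schwartz_le ((hgs N).sub contDiff_const) ψ h1 (k + 1) x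
        rw [le_div_iff₀ (hN N)]
        refine le_trans ?_ h2
        rw [pow_succ, mul_right_comm]
        gcongr
    have hl : Tendsto (fun N : ℕ => B * S / ((N : ℝ) + 1)) atTop (𝓝 0) :=
      tendsto_const_nhds.div_atTop (tendsto_natCast_atTop_atTop.atTop_add tendsto_const_nhds)
    filter_upwards [hl.eventually_lt_const hε] with N hN'
    exact (hbound N).trans_lt hN'
  have e1 : Tendsto (fun N => T₁ (u N)) atTop (𝓝 (T₁ ψ)) := (T₁.continuous.tendsto ψ).comp hlim
  have e2 : Tendsto (fun N => T₂ (u N)) atTop (𝓝 (T₂ ψ)) := (T₂.continuous.tendsto ψ).comp hlim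
  refine tendsto_nhds_unique e1 (e2.congr fun N => (h _ ?_).symm)
  have : ⇑(u N) = fun x => g N x * ψ x := funext (hu N)
  rw [this]
  exact (hgc N).mul_right

end Schwartz

/-- The `L^p` norms of `(g η)^∨` are bounded uniformly over all multipliers `g` with prescribed
bounds on their derivatives: `H ↦ ‖H^∨‖_p` is a continuous seminorm on the Schwartz space. -/
lemma exists_eLpNorm_fourierInv_le {E : Type*} [NormedAddCommGroup E] [InnerProductSpace ℝ E]
    [FiniteDimensional ℝ E] [MeasurableSpace E] [BorelSpace E] (η : 𝓢(E, ℂ)) (p : ℝ≥0∞)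
    [Fact (1 ≤ p)] (c : ℕ → ℝ) :
    ∃ M : ℝ≥0, ∀ (g : E → ℂ) (H : 𝓢(E, ℂ)), ContDiff ℝ (⊤ : ℕ∞) g →
      (∀ i x, ‖iteratedFDeriv ℝ i g x‖ ≤ c i) → (∀ x, H x = g x * η x) →
      eLpNorm (𝓕⁻ H : 𝓢(E, ℂ)) p volume ≤ M := by
  let A : 𝓢(E, ℂ) →L[ℝ] Lp ℂ p (volume : Measure E) :=
    (SchwartzMap.toLpCLM ℝ ℂ p volume) ∘L (fourierInvCLM ℝ 𝓢(E, ℂ))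
  let Q : Seminorm ℝ 𝓢(E, ℂ) := (normSeminorm ℝ (Lp ℂ p (volume : Measure E))).comp A.toLinearMap
  have hQ : Continuous Q := continuous_norm.comp A.continuous
  obtain ⟨s, C, -, hs⟩ := Seminorm.bound_of_continuous (schwartz_withSeminorms ℝ E ℂ) Q hQ
  let B : ℕ → ℝ := fun n => ∑ i ∈ Finset.range (n + 1), |c i|
  let S : ℕ × ℕ → ℝ := fun m => B m.2 * ∑ i ∈ Finset.range (m.2 + 1),
    (m.2.choose i) * SchwartzMap.seminorm ℝ m.1 (m.2 - i) η
  have hS (m) : 0 ≤ S m := by positivity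
  refine ⟨(C * ∑ m ∈ s, S m).toNNReal, fun g H hg hgc hH => ?_⟩
  have h1 : ‖(𝓕⁻ H : 𝓢(E, ℂ)).toLp p volume‖ ≤ C * ∑ m ∈ s, S m := by
    refine (hs H).trans ?_
    change (C : ℝ) * s.sup (schwartzSeminormFamily ℝ E ℂ) H ≤ _
    gcongr
    refine Seminorm.finset_sup_apply_le (Finset.sum_nonneg fun m _ => hS m) fun m hm => ?_
    refine le_trans ?_ (Finset.single_le_sum (fun m _ => hS m) hm)
    refine SchwartzMap.seminorm_le_bound ℝ m.1 m.2 _ (hS m) fun x => ?_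
    have hfun : ⇑H = fun y => g y * η y := funext hH
    rw [hfun]
    refine norm_iteratedFDeriv_smul_schwartz_le hg η (fun i hi x => ?_) m.1 x
    exact ((hgc i x).trans (le_abs_self _)).trans (Finset.single_le_sum (f := fun i => |c i|)
      (fun _ _ => abs_nonneg _) (by simpa [Nat.lt_succ_iff] using hi))
  rw [SchwartzMap.norm_toLp] at h1
  rw [← ENNReal.ofReal_toReal ((𝓕⁻ H : 𝓢(E, ℂ)).eLpNorm_lt_top p volume).ne]
  exact ENNReal.ofReal_le_ofReal h1

/-! ### Dyadic resolutions of unity and Besov norms -/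

section Dyadic

variable {d : ℕ}

lemma hasTemperateGrowth_ofReal (φ : 𝓢(EuclideanSpace ℝ (Fin d), ℝ)) :
    (fun x => ((φ x : ℝ) : ℂ)).HasTemperateGrowth :=
  (φ.postcompCLM (𝕜 := ℝ) Complex.ofRealCLM).hasTemperateGrowth

namespace IsDyadicResolution

variable {φ : ℕ → 𝓢(EuclideanSpace ℝ (Fin d), ℝ)} (hφ : IsDyadicResolution φ)
include hφ

lemma norm_le_of_ne_zero {j : ℕ} {x : EuclideanSpace ℝ (Fin d)} (hx : φ j x ≠ 0) :
    ‖x‖ ≤ 2 ^ (j + 1) := by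
  have hx' : x ∈ tsupport (φ j) := subset_tsupport _ hx
  rcases Nat.eq_zero_or_pos j with rfl | hj
  · simpa using hφ.tsupport_zero hx'
  · exact_mod_cast (hφ.tsupport_pos j hj hx').2

lemma le_norm_of_ne_zero {j : ℕ} {x : EuclideanSpace ℝ (Fin d)} (hx : φ (j + 1) x ≠ 0) :
    2 ^ j ≤ ‖x‖ := by
  have hx' : x ∈ tsupport (φ (j + 1)) := subset_tsupport _ hx
  have := (hφ.tsupport_pos (j + 1) (by omega) hx').1
  have e : (((j + 1 : ℕ) : ℝ) - 1) = (j : ℝ) := by push_cast; ring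
  rw [e] at this
  exact_mod_cast this

lemma sum_range_eq_one {N : ℕ} {x : EuclideanSpace ℝ (Fin d)} (hx : ‖x‖ < 2 ^ N) :
    ∑ j ∈ Finset.range (N + 1), φ j x = 1 := by
  refine HasSum.unique (hasSum_sum_of_ne_finset_zero fun j hj => ?_) (hφ.hasSum_one x)
  by_contra hne
  obtain ⟨k, rfl⟩ : ∃ k, j = k + 1 := ⟨j - 1, by simp at hj; omega⟩
  have h1 := hφ.le_norm_of_ne_zero hne
  have h2 : (2 : ℝ) ^ N ≤ 2 ^ k := pow_le_pow_right₀ (by norm_num) (by simp at hj; omega)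
  linarith

lemma tsum_ofReal (x : EuclideanSpace ℝ (Fin d)) : ∑' j, ENNReal.ofReal (φ j x) = 1 := by
  rw [← ENNReal.ofReal_tsum_of_nonneg (fun j => hφ.nonneg j x) (hφ.hasSum_one x).summable,
    (hφ.hasSum_one x).tsum_eq, ENNReal.ofReal_one]

lemma two_rpow_mul_le {s : ℝ} (hs : 0 ≤ s) (j : ℕ) (x : EuclideanSpace ℝ (Fin d)) :
    (2 : ℝ) ^ (s * j) * φ j x ≤ 2 ^ s * (1 + ‖x‖ ^ s) * φ j x := by
  rcases eq_or_ne (φ j x) 0 with h0 | h0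
  · simp [h0]
  refine mul_le_mul_of_nonneg_right ?_ (hφ.nonneg j x)
  have hxs : 0 ≤ ‖x‖ ^ s := by positivity
  have h2s : 1 ≤ (2 : ℝ) ^ s := Real.one_le_rpow (by norm_num) hs
  rcases j with _ | j
  · simp; nlinarith
  · have h1 := hφ.le_norm_of_ne_zero h0
    have h2 : (2 : ℝ) ^ (s * j) ≤ ‖x‖ ^ s := by
      rw [mul_comm, Real.rpow_mul (by norm_num), Real.rpow_natCast]
      gcongr
    have h3 : (2 : ℝ) ^ (s * (j + 1 : ℕ)) = 2 ^ s * 2 ^ (s * j) := by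
      rw [← Real.rpow_add (by norm_num)]; congr 1; push_cast; ring
    rw [h3]
    nlinarith

end IsDyadicResolution

lemma besovNorm_one (φ : ℕ → 𝓢(EuclideanSpace ℝ (Fin d), ℝ)) (α : ℝ) (p : ℝ≥0∞) [Fact (1 ≤ p)]
    (f : 𝓢'(EuclideanSpace ℝ (Fin d), ℂ)) :
    besovNorm φ α p 1 f =
      ∑' j : ℕ, ENNReal.ofReal ((2 : ℝ) ^ (α * j)) * distLpNorm p (dyadicPiece (φ j) f) := by
  simp [besovNorm]

/-- A single dyadic piece is controlled by the Besov norm. -/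
lemma le_besovNorm (φ : ℕ → 𝓢(EuclideanSpace ℝ (Fin d), ℝ)) (α : ℝ) (p : ℝ≥0∞) [Fact (1 ≤ p)]
    {q : ℝ≥0∞} (hq : 1 ≤ q) (f : 𝓢'(EuclideanSpace ℝ (Fin d), ℂ)) (j : ℕ) :
    ENNReal.ofReal ((2 : ℝ) ^ (α * j)) * distLpNorm p (dyadicPiece (φ j) f) ≤
      besovNorm φ α p q f := by
  unfold besovNorm
  split_ifs with h
  · exact le_iSup (fun j : ℕ =>
      ENNReal.ofReal ((2 : ℝ) ^ (α * j)) * distLpNorm p (dyadicPiece (φ j) f)) j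
  · have hq0 : 0 < q.toReal := ENNReal.toReal_pos (by positivity) h
    rw [one_div, ENNReal.le_rpow_inv_iff hq0]
    refine le_trans (le_of_eq ?_) (ENNReal.le_tsum j)
    rw [ENNReal.mul_rpow_of_nonneg _ _ hq0.le, ENNReal.ofReal_rpow_of_nonneg (by positivity) hq0.le,
      ← Real.rpow_mul (by norm_num)]
    ring_nf

/-- The Besov norms decrease with `q` and increase with `α`. -/
lemma besovNorm_le_besovNorm_one (φ : ℕ → 𝓢(EuclideanSpace ℝ (Fin d), ℝ)) {α β : ℝ} (h : α ≤ β)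
    (p : ℝ≥0∞) [Fact (1 ≤ p)] {q : ℝ≥0∞} (hq : 1 ≤ q) (f : 𝓢'(EuclideanSpace ℝ (Fin d), ℂ)) :
    besovNorm φ α p q f ≤ besovNorm φ β p 1 f := by
  rw [besovNorm_one]
  set a : ℕ → ℝ≥0∞ := fun j =>
    ENNReal.ofReal ((2 : ℝ) ^ (β * j)) * distLpNorm p (dyadicPiece (φ j) f) with ha
  have hle (j : ℕ) :
      ENNReal.ofReal ((2 : ℝ) ^ (α * j)) * distLpNorm p (dyadicPiece (φ j) f) ≤ a j := by
    refine mul_le_mul_left (ENNReal.ofReal_le_ofReal ?_) _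
    exact Real.rpow_le_rpow_of_exponent_le (by norm_num) (by gcongr)
  unfold besovNorm
  split_ifs with hq'
  · exact iSup_le fun j => (hle j).trans (ENNReal.le_tsum j)
  · have hq1 : 1 ≤ q.toReal := by
      simpa using (ENNReal.toReal_le_toReal (by simp) hq').2 hq
    have hq0 : 0 < q.toReal := by linarith
    rw [one_div, ENNReal.rpow_inv_le_iff hq0]
    calc _ ≤ ∑' j, a j * (∑' i, a i) ^ (q.toReal - 1) := by
          refine ENNReal.tsum_le_tsum fun j => ?_
          have e : ENNReal.ofReal ((2 : ℝ) ^ (α * q.toReal * j)) *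
              distLpNorm p (dyadicPiece (φ j) f) ^ q.toReal =
              (ENNReal.ofReal ((2 : ℝ) ^ (α * j)) * distLpNorm p (dyadicPiece (φ j) f)) ^ q.toReal := by
            rw [ENNReal.mul_rpow_of_nonneg _ _ hq0.le,
              ENNReal.ofReal_rpow_of_nonneg (by positivity) hq0.le, ← Real.rpow_mul (by norm_num)]
            ring_nf
          rw [e]
          calc _ ≤ a j ^ q.toReal := by gcongr; exact hle j
            _ = a j ^ (1 + (q.toReal - 1)) := by ring_nf
            _ = a j * a j ^ (q.toReal - 1) := by
              rw [ENNReal.rpow_add_of_nonneg _ _ (by norm_num) (by linarith), ENNReal.rpow_one]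
            _ ≤ _ := by
              gcongr
              exact ENNReal.le_tsum j
      _ = (∑' i, a i) ^ q.toReal := by
        rw [ENNReal.tsum_mul_right]
        conv_rhs => rw [show q.toReal = 1 + (q.toReal - 1) by ring,
          ENNReal.rpow_add_of_nonneg _ _ (by norm_num) (by linarith), ENNReal.rpow_one]

lemma dyadicPiece_apply (φ : 𝓢(EuclideanSpace ℝ (Fin d), ℝ))
    (f : 𝓢'(EuclideanSpace ℝ (Fin d), ℂ)) (ψ : 𝓢(EuclideanSpace ℝ (Fin d), ℂ)) :
    dyadicPiece φ f ψ = 𝓕 f (SchwartzMap.smulLeftCLM ℂ (fun x => ((φ x : ℝ) : ℂ)) (𝓕⁻ ψ)) := rfl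

lemma fourier_dyadicPiece (φ : 𝓢(EuclideanSpace ℝ (Fin d), ℝ))
    (f : 𝓢'(EuclideanSpace ℝ (Fin d), ℂ)) :
    𝓕 (dyadicPiece φ f) =
      TemperedDistribution.smulLeftCLM ℂ (fun x => ((φ x : ℝ) : ℂ)) (𝓕 f) :=
  FourierTransform.fourier_fourierInv_eq _

/-- If `f̂` is a function in `L¹`, then `(φ f̂)^∨` is bounded by `∫ φ |f̂|`. -/
lemma distLpNorm_top_dyadicPiece_le (φ : 𝓢(EuclideanSpace ℝ (Fin d), ℝ)) (hφ : ∀ x, 0 ≤ φ x)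
    (f : 𝓢'(EuclideanSpace ℝ (Fin d), ℂ))
    (g : Lp ℂ 1 (volume : Measure (EuclideanSpace ℝ (Fin d))))
    (hg : Lp.toTemperedDistribution g = 𝓕 f) :
    distLpNorm ∞ (dyadicPiece φ f) ≤ ∫⁻ ξ, ENNReal.ofReal (φ ξ) * ‖g ξ‖ₑ := by
  have hm : MemLp (fun x => ((φ x : ℝ) : ℂ)) ∞ (volume : Measure (EuclideanSpace ℝ (Fin d))) :=
    (φ.postcompCLM (𝕜 := ℝ) Complex.ofRealCLM).memLp_top volume
  have h := Lp.toTemperedDistribution_smul_eq (r := 1) (hasTemperateGrowth_ofReal φ) hm g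
  rw [dyadicPiece, ← hg, ← h]
  refine (distLpNorm_top_fourierInv_le _).trans (le_of_eq (lintegral_congr_ae ?_))
  filter_upwards [Lp.coeFn_lpSMul (r := 1) (hm.toLp _) g, hm.coeFn_toLp] with x h1 h2
  rw [h1, Pi.smul_apply', h2, enorm_smul, ← ofReal_norm, Complex.norm_real,
    Real.norm_of_nonneg (hφ x)]

/-- The embedding of the spectral Barron space into `B^s_{∞,1}`. -/
theorem besovNorm_top_one_le_barronNorm {φ : ℕ → 𝓢(EuclideanSpace ℝ (Fin d), ℝ)}
    (hφ : IsDyadicResolution φ) {s : ℝ} (hs : 0 ≤ s) (f : 𝓢'(EuclideanSpace ℝ (Fin d), ℂ)) :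
    ENNReal.ofReal ((2 : ℝ) ^ (-s)) * besovNorm φ s ∞ 1 f ≤ barronNorm s f := by
  refine le_iInf₂ fun g hg => ?_
  have hgm : AEMeasurable (fun ξ => ‖g ξ‖ₑ) volume := (Lp.aestronglyMeasurable g).enorm
  have hφm (j : ℕ) : Measurable fun ξ => ENNReal.ofReal (φ j ξ) :=
    (φ j).continuous.measurable.ennreal_ofReal
  have h1 : besovNorm φ s ∞ 1 f ≤
      ENNReal.ofReal (2 ^ s) * ∫⁻ ξ, ENNReal.ofReal (1 + ‖ξ‖ ^ s) * ‖g ξ‖ₑ := by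
    rw [besovNorm_one]
    calc _ ≤ ∑' j : ℕ, ∫⁻ ξ, ENNReal.ofReal ((2 : ℝ) ^ (s * j)) *
            (ENNReal.ofReal (φ j ξ) * ‖g ξ‖ₑ) := by
          refine ENNReal.tsum_le_tsum fun j => ?_
          rw [lintegral_const_mul' _ _ ENNReal.ofReal_ne_top]
          gcongr
          exact distLpNorm_top_dyadicPiece_le (φ j) (hφ.nonneg j) f g hg
      _ = ∫⁻ ξ, ∑' j : ℕ, ENNReal.ofReal ((2 : ℝ) ^ (s * j)) *
            (ENNReal.ofReal (φ j ξ) * ‖g ξ‖ₑ) :=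
          (lintegral_tsum fun j => ((hφm j).aemeasurable.mul hgm).const_mul _).symm
      _ ≤ ∫⁻ ξ, ENNReal.ofReal (2 ^ s) * (ENNReal.ofReal (1 + ‖ξ‖ ^ s) * ‖g ξ‖ₑ) := by
          refine lintegral_mono fun ξ => ?_
          calc _ ≤ ∑' j : ℕ, ENNReal.ofReal (2 ^ s * (1 + ‖ξ‖ ^ s)) * ‖g ξ‖ₑ *
                  ENNReal.ofReal (φ j ξ) := by
                refine ENNReal.tsum_le_tsum fun j => ?_
                rw [← mul_assoc, ← ENNReal.ofReal_mul (by positivity), mul_right_comm,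
                  ← ENNReal.ofReal_mul (by positivity)]
                exact mul_le_mul_left (ENNReal.ofReal_le_ofReal (hφ.two_rpow_mul_le hs j ξ)) _
            _ = _ := by
                rw [ENNReal.tsum_mul_left, hφ.tsum_ofReal, mul_one,
                  ENNReal.ofReal_mul (by positivity), mul_assoc]
      _ = _ := lintegral_const_mul' _ _ ENNReal.ofReal_ne_top
  calc _ ≤ ENNReal.ofReal ((2 : ℝ) ^ (-s)) *
        (ENNReal.ofReal (2 ^ s) * ∫⁻ ξ, ENNReal.ofReal (1 + ‖ξ‖ ^ s) * ‖g ξ‖ₑ) := by gcongr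
    _ = _ := by
      rw [← mul_assoc, ← ENNReal.ofReal_mul (by positivity), ← Real.rpow_add (by norm_num)]
      simp

end Dyadic

/-! ### The embedding of `B^{s+d/2}_{2,1}` into the spectral Barron space -/

section BesovToBarron

variable {d : ℕ}

/-- If `φ T` is an `L²` function and `φ` vanishes off a ball, then so does this function. -/
lemma ae_eq_zero_of_smulLeftCLM {φ : 𝓢(EuclideanSpace ℝ (Fin d), ℝ)} {R : ℝ}
    (hφ : ∀ x, R < ‖x‖ → φ x = 0) {T : 𝓢'(EuclideanSpace ℝ (Fin d), ℂ)}
    {g : Lp ℂ 2 (volume : Measure (EuclideanSpace ℝ (Fin d)))}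
    (hg : Lp.toTemperedDistribution g =
      TemperedDistribution.smulLeftCLM ℂ (fun x => ((φ x : ℝ) : ℂ)) T) :
    ∀ᵐ x ∂(volume : Measure (EuclideanSpace ℝ (Fin d))), R < ‖x‖ → g x = 0 := by
  have hU : IsOpen {x : EuclideanSpace ℝ (Fin d) | R < ‖x‖} :=
    isOpen_lt continuous_const continuous_norm
  refine hU.ae_eq_zero_of_integral_contDiff_smul_eq_zero
    (((Lp.memLp g).locallyIntegrable (by norm_num)).locallyIntegrableOn _) fun ψ hψ hψc hψs => ?_
  have h1 : HasCompactSupport (fun x => ((ψ x : ℝ) : ℂ)) :=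
    hψc.comp_left (g := fun t : ℝ => (t : ℂ)) rfl
  have h2 : ContDiff ℝ (⊤ : ℕ∞) (fun x => ((ψ x : ℝ) : ℂ)) :=
    Complex.ofRealCLM.contDiff.comp hψ
  have h3 := congrArg (fun S => S (h1.toSchwartzMap h2)) hg
  have h4 : SchwartzMap.smulLeftCLM ℂ (fun x => ((φ x : ℝ) : ℂ)) (h1.toSchwartzMap h2) = 0 := by
    ext x
    rw [SchwartzMap.smulLeftCLM_apply_apply (hasTemperateGrowth_ofReal φ)]
    by_cases hx : R < ‖x‖
    · simp [hφ x hx]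
    · have : ψ x = 0 := by
        by_contra hne
        exact hx (hψs (subset_tsupport _ hne))
      simp [this]
  simp only [Lp.toTemperedDistribution_apply, TemperedDistribution.smulLeftCLM_apply_apply, h4,
    map_zero] at h3
  simpa using h3

lemma unitBallVolume_pos (d : ℕ) : 0 < unitBallVolume d :=
  ENNReal.toReal_pos (Metric.measure_ball_pos _ _ one_pos).ne' measure_ball_lt_top.ne

lemma volume_closedBall_eq {R : ℝ} (hR : 0 ≤ R) :
    volume (Metric.closedBall (0 : EuclideanSpace ℝ (Fin d)) R) =
      ENNReal.ofReal (R ^ d * unitBallVolume d) := by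
  rw [Measure.addHaar_closedBall _ _ hR, ENNReal.ofReal_mul (by positivity), unitBallVolume,
    ofReal_measureReal (measure_ball_lt_top.ne)]
  simp

/-- Cauchy–Schwarz on a ball. -/
lemma setLIntegral_closedBall_le {f : EuclideanSpace ℝ (Fin d) → ℂ}
    (hf : AEStronglyMeasurable f volume) {R : ℝ} (hR : 0 ≤ R) :
    ∫⁻ ξ in Metric.closedBall 0 R, ‖f ξ‖ₑ ≤
      ENNReal.ofReal (√(R ^ d * unitBallVolume d)) * eLpNorm f 2 volume := by
  have hν := unitBallVolume_pos d
  have h3 := eLpNorm_le_eLpNorm_mul_rpow_measure_univ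
    (μ := volume.restrict (Metric.closedBall 0 R)) (p := 1) (q := 2) (by norm_num) hf.restrict
  rw [eLpNorm_one_eq_lintegral_enorm, Measure.restrict_apply_univ,
    volume_closedBall_eq hR, ENNReal.ofReal_rpow_of_nonneg (by positivity) (by norm_num),
    mul_comm] at h3
  refine h3.trans ?_
  gcongr
  · rw [Real.sqrt_eq_rpow]
    norm_num
  · exact Measure.restrict_le_self

lemma lintegral_weight_le {R s : ℝ} (hR : 1 ≤ R) (hs : 0 ≤ s)
    (g : Lp ℂ 2 (volume : Measure (EuclideanSpace ℝ (Fin d))))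
    (hg : ∀ᵐ x ∂(volume : Measure (EuclideanSpace ℝ (Fin d))), R < ‖x‖ → g x = 0) :
    ∫⁻ ξ, ENNReal.ofReal (1 + ‖ξ‖ ^ s) * ‖g ξ‖ₑ ≤
      ENNReal.ofReal (2 * R ^ s * √(R ^ d * unitBallVolume d)) * ‖g‖ₑ := by
  set B := Metric.closedBall (0 : EuclideanSpace ℝ (Fin d)) R with hB
  have hgm : AEStronglyMeasurable g (volume : Measure (EuclideanSpace ℝ (Fin d))) :=
    Lp.aestronglyMeasurable g
  have hν := unitBallVolume_pos d
  have hR0 : 0 < R := by linarith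
  have h1 : ∫⁻ ξ, ENNReal.ofReal (1 + ‖ξ‖ ^ s) * ‖g ξ‖ₑ ≤
      ∫⁻ ξ, ENNReal.ofReal (2 * R ^ s) * B.indicator (fun ξ => ‖g ξ‖ₑ) ξ := by
    refine lintegral_mono_ae ?_
    filter_upwards [hg] with ξ hξ
    by_cases hx : R < ‖ξ‖
    · simp [hξ hx]
    · have hxB : ξ ∈ B := by simpa [hB] using not_lt.1 hx
      rw [Set.indicator_of_mem hxB]
      gcongr
      have h2 : ‖ξ‖ ^ s ≤ R ^ s := by gcongr; exact not_lt.1 hx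
      have h3 : 1 ≤ R ^ s := Real.one_le_rpow hR hs
      linarith
  calc _ ≤ _ := h1
    _ = ENNReal.ofReal (2 * R ^ s) * ∫⁻ ξ in B, ‖g ξ‖ₑ := by
      rw [lintegral_const_mul' _ _ ENNReal.ofReal_ne_top,
        lintegral_indicator Metric.isClosed_closedBall.measurableSet]
    _ ≤ ENNReal.ofReal (2 * R ^ s) *
        (ENNReal.ofReal (√(R ^ d * unitBallVolume d)) * ‖g‖ₑ) := by
      gcongr
      exact Lp.enorm_def g ▸ setLIntegral_closedBall_le hgm hR0.le
    _ = _ := by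
      rw [ENNReal.ofReal_mul (p := 2 * R ^ s) (by positivity), mul_assoc]

/-- Near every compact set only finitely many members of the resolution contribute. -/
lemma IsDyadicResolution.hasSum_smulLeftCLM {φ : ℕ → 𝓢(EuclideanSpace ℝ (Fin d), ℝ)}
    (hφ : IsDyadicResolution φ) (T : 𝓢'(EuclideanSpace ℝ (Fin d), ℂ))
    {ψ : 𝓢(EuclideanSpace ℝ (Fin d), ℂ)} (hψ : HasCompactSupport ψ) :
    HasSum (fun j => T (SchwartzMap.smulLeftCLM ℂ (fun x => ((φ j x : ℝ) : ℂ)) ψ)) (T ψ) := by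
  obtain ⟨R, hR⟩ := hψ.isCompact.isBounded.exists_norm_le
  obtain ⟨N, hN⟩ := pow_unbounded_of_one_lt R (one_lt_two (α := ℝ))
  have hsupp (x) (hx : ψ x ≠ 0) : ‖x‖ < 2 ^ N :=
    (hR x (subset_tsupport _ hx)).trans_lt hN
  have hsum : ∑ j ∈ Finset.range (N + 1),
      SchwartzMap.smulLeftCLM ℂ (fun x => ((φ j x : ℝ) : ℂ)) ψ = ψ := by
    ext x
    simp only [sum_apply,
      SchwartzMap.smulLeftCLM_apply_apply (hasTemperateGrowth_ofReal _), smul_eq_mul]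
    rw [← Finset.sum_mul]
    by_cases hx : ψ x = 0
    · simp [hx]
    · have := hφ.sum_range_eq_one (hsupp x hx)
      rw [← Complex.ofReal_sum, this]; simp
  have key : HasSum (fun j => T (SchwartzMap.smulLeftCLM ℂ (fun x => ((φ j x : ℝ) : ℂ)) ψ))
      (∑ j ∈ Finset.range (N + 1),
        T (SchwartzMap.smulLeftCLM ℂ (fun x => ((φ j x : ℝ) : ℂ)) ψ)) := by
    refine hasSum_sum_of_ne_finset_zero fun j hj => ?_
    have : SchwartzMap.smulLeftCLM ℂ (fun x => ((φ j x : ℝ) : ℂ)) ψ = 0 := by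
      ext x
      rw [SchwartzMap.smulLeftCLM_apply_apply (hasTemperateGrowth_ofReal _)]
      by_cases hx : ψ x = 0
      · simp [hx]
      · have h0 : φ j x = 0 := by
          by_contra hne
          obtain ⟨k, rfl⟩ : ∃ k, j = k + 1 := ⟨j - 1, by simp at hj; omega⟩
          have h1 := hφ.le_norm_of_ne_zero hne
          have h2 : (2 : ℝ) ^ N ≤ 2 ^ k := pow_le_pow_right₀ (by norm_num) (by simp at hj; omega)
          linarith [hsupp x hx]
        simp [h0]
    rw [this, map_zero]
  rwa [← map_sum, hsum] at key

lemma barron_const_eq (s : ℝ) (d j : ℕ) (ν : ℝ) :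
    2 * ((2 : ℝ) ^ (j + 1)) ^ s * √(((2 : ℝ) ^ (j + 1)) ^ d * ν) =
      2 ^ (s + 1 + d / 2 : ℝ) * √ν * 2 ^ ((s + d / 2) * j) := by
  have h0 : (0 : ℝ) < 2 := by norm_num
  rw [Real.sqrt_mul (by positivity), Real.sqrt_eq_rpow, ← Real.rpow_natCast, ← Real.rpow_natCast,
    ← Real.rpow_mul h0.le, ← Real.rpow_mul h0.le, ← Real.rpow_mul h0.le]
  have : (2 : ℝ) * 2 ^ (((j + 1 : ℕ) : ℝ) * s) * 2 ^ (((j + 1 : ℕ) : ℝ) * d * (1 / 2)) =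
      2 ^ (s + 1 + d / 2 : ℝ) * 2 ^ ((s + d / 2) * j) := by
    nth_rewrite 1 [← Real.rpow_one 2]
    rw [← Real.rpow_add h0, ← Real.rpow_add h0, ← Real.rpow_add h0]
    congr 1; push_cast; ring
  rw [← mul_assoc, this]; ring

/-- The embedding of `B^{s+d/2}_{2,1}` into the spectral Barron space: by Plancherel each `φ_j f̂` is
an `L²` function `g_j`, the Cauchy–Schwarz inequality on the ball of radius `2^{j+1}` bounds its
weighted `L¹` norm, and `f̂ = ∑ g_j`. -/
theorem barronNorm_le_besovNorm {φ : ℕ → 𝓢(EuclideanSpace ℝ (Fin d), ℝ)}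
    (hφ : IsDyadicResolution φ) {s : ℝ} (hs : 0 ≤ s) (f : 𝓢'(EuclideanSpace ℝ (Fin d), ℂ)) :
    barronNorm s f ≤ ENNReal.ofReal ((2 : ℝ) ^ (s + 1 + d / 2 : ℝ) * √(unitBallVolume d)) *
      besovNorm φ (s + d / 2) 2 1 f := by
  have hν := unitBallVolume_pos d
  have hK : 0 < (2 : ℝ) ^ (s + 1 + d / 2 : ℝ) * √(unitBallVolume d) := by positivity
  set K := (2 : ℝ) ^ (s + 1 + d / 2 : ℝ) * √(unitBallVolume d) with hKdef
  rcases eq_or_ne (besovNorm φ (s + d / 2) 2 1 f) ∞ with htop | htop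
  · rw [htop, ENNReal.mul_top (by simpa using hK)]; exact le_top
  have hpiece (j : ℕ) : distLpNorm 2 (dyadicPiece (φ j) f) < ∞ := by
    have h1 := le_besovNorm φ (s + d / 2) 2 le_rfl f j
    by_contra hcon
    rw [not_lt, top_le_iff] at hcon
    rw [hcon, ENNReal.mul_top (by simpa using Real.rpow_pos_of_pos (by norm_num) _),
      top_le_iff] at h1
    exact htop h1
  choose u hu hun using fun j => exists_of_distLpNorm_lt_top (hpiece j)
  let g : ℕ → Lp ℂ 2 (volume : Measure (EuclideanSpace ℝ (Fin d))) := fun j => 𝓕 (u j)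
  have hg (j) : Lp.toTemperedDistribution (g j) =
      TemperedDistribution.smulLeftCLM ℂ (fun x => ((φ j x : ℝ) : ℂ)) (𝓕 f) := by
    rw [← fourier_dyadicPiece, ← hu j]
    exact (Lp.fourier_toTemperedDistribution_eq (u j)).symm
  have hgn (j) : ‖g j‖ₑ = distLpNorm 2 (dyadicPiece (φ j) f) := by
    rw [hun j, enorm_eq_iff_norm_eq]
    exact Lp.norm_fourier_eq (u j)
  have hg0 (j) := ae_eq_zero_of_smulLeftCLM (R := 2 ^ (j + 1)) (fun x hx => by
    by_contra hne
    exact absurd (hφ.norm_le_of_ne_zero hne) (not_le.2 hx)) (hg j)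
  have hgm (j) : AEStronglyMeasurable (g j) (volume : Measure (EuclideanSpace ℝ (Fin d))) :=
    Lp.aestronglyMeasurable (g j)
  have hw : Measurable fun ξ : EuclideanSpace ℝ (Fin d) => ENNReal.ofReal (1 + ‖ξ‖ ^ s) := by
    fun_prop
  have hgw (j : ℕ) : ∫⁻ ξ, ENNReal.ofReal (1 + ‖ξ‖ ^ s) * ‖g j ξ‖ₑ ≤
      ENNReal.ofReal K * (ENNReal.ofReal ((2 : ℝ) ^ ((s + d / 2) * j)) *
        distLpNorm 2 (dyadicPiece (φ j) f)) := by
    refine (lintegral_weight_le (one_le_pow₀ (by norm_num)) hs (g j) (hg0 j)).trans_eq ?_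
    rw [barron_const_eq, hgn, ENNReal.ofReal_mul hK.le, mul_assoc]
  have hsum : ∑' j, ∫⁻ ξ, ENNReal.ofReal (1 + ‖ξ‖ ^ s) * ‖g j ξ‖ₑ ≤
      ENNReal.ofReal K * besovNorm φ (s + d / 2) 2 1 f := by
    rw [besovNorm_one, ← ENNReal.tsum_mul_left]
    exact ENNReal.tsum_le_tsum hgw
  have hfin : ENNReal.ofReal K * besovNorm φ (s + d / 2) 2 1 f < ∞ :=
    ENNReal.mul_lt_top ENNReal.ofReal_lt_top htop.lt_top
  have hone (ξ : EuclideanSpace ℝ (Fin d)) (z : ℂ) :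
      ‖z‖ₑ ≤ ENNReal.ofReal (1 + ‖ξ‖ ^ s) * ‖z‖ₑ := by
    refine le_mul_of_one_le_left (by simp) ?_
    rw [ENNReal.one_le_ofReal]
    have : 0 ≤ ‖ξ‖ ^ s := by positivity
    linarith
  -- Where the series diverges the sum takes the value `0`; the bounds below hold there as well.
  let G : EuclideanSpace ℝ (Fin d) → ℂ := fun ξ => ∑' j, g j ξ
  have hGw : ∫⁻ ξ, ENNReal.ofReal (1 + ‖ξ‖ ^ s) * ‖G ξ‖ₑ ≤
      ENNReal.ofReal K * besovNorm φ (s + d / 2) 2 1 f := by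
    refine le_trans ?_ hsum
    have hm (j) : AEMeasurable (fun ξ => ENNReal.ofReal (1 + ‖ξ‖ ^ s) * ‖g j ξ‖ₑ) volume :=
      hw.aemeasurable.mul (hgm j).enorm
    rw [← lintegral_tsum hm]
    refine lintegral_mono fun ξ => ?_
    rw [ENNReal.tsum_mul_left]
    gcongr
    exact enorm_tsum_le_tsum_enorm
  have hGm : MemLp G 1 (volume : Measure (EuclideanSpace ℝ (Fin d))) := by
    refine ⟨AEStronglyMeasurable.tsum hgm, ?_⟩
    rw [eLpNorm_one_eq_lintegral_enorm]
    exact ((lintegral_mono fun ξ => hone ξ (G ξ)).trans hGw).trans_lt hfin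
  -- Identify `G` with `f̂` on compactly supported test functions, where `f̂ = ∑ φ_j f̂` is a finite sum.
  have hGf : Lp.toTemperedDistribution (hGm.toLp G) = 𝓕 f := by
    refine temperedDistribution_ext_of_hasCompactSupport fun ψ hψ => ?_
    have h1 := (hφ.hasSum_smulLeftCLM (𝓕 f) hψ).tsum_eq
    rw [← h1]
    have h2 (j) : (𝓕 f) (SchwartzMap.smulLeftCLM ℂ (fun x => ((φ j x : ℝ) : ℂ)) ψ) =
        ∫ x, ψ x • g j x := by
      rw [← Lp.toTemperedDistribution_apply, hg j]; rfl
    simp_rw [h2]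
    have hm (j) : AEStronglyMeasurable (fun x => ψ x • g j x) volume :=
      ψ.continuous.aestronglyMeasurable.smul (hgm j)
    rw [← integral_tsum hm,
      Lp.toTemperedDistribution_apply]
    · refine integral_congr_ae ?_
      filter_upwards [hGm.coeFn_toLp] with x hx
      simp only [hx, G, smul_eq_mul]
      exact tsum_mul_left.symm
    · have hb : ∑' j, ∫⁻ x, ‖ψ x • g j x‖ₑ ≤
          ENNReal.ofReal (SchwartzMap.seminorm ℝ 0 0 ψ) *
            ∑' j, ∫⁻ ξ, ENNReal.ofReal (1 + ‖ξ‖ ^ s) * ‖g j ξ‖ₑ := by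
        rw [← ENNReal.tsum_mul_left]
        refine ENNReal.tsum_le_tsum fun j => ?_
        rw [← lintegral_const_mul' _ _ ENNReal.ofReal_ne_top]
        refine lintegral_mono fun x => ?_
        rw [enorm_smul]
        gcongr
        · rw [← ofReal_norm]
          exact ENNReal.ofReal_le_ofReal (ψ.norm_le_seminorm ℝ x)
        · exact hone x _
      exact (hb.trans_lt (ENNReal.mul_lt_top ENNReal.ofReal_lt_top (hsum.trans_lt hfin))).ne
  refine (iInf₂_le (hGm.toLp G) hGf).trans (le_of_eq_of_le (lintegral_congr_ae ?_) hGw)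
  filter_upwards [hGm.coeFn_toLp] with x hx
  rw [hx]

end BesovToBarron

/-! ### Bernstein's inequality -/

section FourierNorms

variable {E : Type*} [NormedAddCommGroup E] [InnerProductSpace ℝ E] [FiniteDimensional ℝ E]
  [MeasurableSpace E] [BorelSpace E]

lemma eLpNorm_fourier_two (F : 𝓢(E, ℂ)) :
    eLpNorm (𝓕 F : 𝓢(E, ℂ)) 2 volume = eLpNorm F 2 volume := by
  have h := SchwartzMap.norm_fourier_toL2_eq F
  rw [SchwartzMap.norm_toLp, SchwartzMap.norm_toLp] at h
  exact (ENNReal.toReal_eq_toReal_iff' (SchwartzMap.eLpNorm_lt_top _ _ _).ne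
    (SchwartzMap.eLpNorm_lt_top _ _ _).ne).1 h

lemma eLpNorm_fourierInv_two (F : 𝓢(E, ℂ)) :
    eLpNorm (𝓕⁻ F : 𝓢(E, ℂ)) 2 volume = eLpNorm F 2 volume := by
  rw [← eLpNorm_fourier_two, FourierTransform.fourier_fourierInv_eq]

lemma eLpNorm_fourier_top_le (F : 𝓢(E, ℂ)) :
    eLpNorm (𝓕 F : 𝓢(E, ℂ)) ∞ volume ≤ eLpNorm F 1 volume := by
  refine eLpNormEssSup_le_of_ae_enorm_bound (.of_forall fun x => ?_)
  rw [← ofReal_norm, ← ENNReal.ofReal_toReal (F.eLpNorm_lt_top 1 volume).ne,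
    ← SchwartzMap.norm_toLp]
  exact ENNReal.ofReal_le_ofReal (F.norm_fourier_apply_le_toLp_one x)

end FourierNorms

section Bernstein

variable {d : ℕ}

/-- Multipliers `χ` that are `1` on the support of `φ` do not change the test functions seen by
`(φ f̂)^∨`. -/
lemma dyadicPiece_apply_fourier {φ χ : 𝓢(EuclideanSpace ℝ (Fin d), ℝ)}
    (h : ∀ x, φ x ≠ 0 → χ x = 1) (f : 𝓢'(EuclideanSpace ℝ (Fin d), ℂ))
    (ψ : 𝓢(EuclideanSpace ℝ (Fin d), ℂ)) :
    dyadicPiece φ f (𝓕 (SchwartzMap.smulLeftCLM ℂ (fun x => ((χ x : ℝ) : ℂ)) (𝓕⁻ ψ))) =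
      dyadicPiece φ f ψ := by
  rw [dyadicPiece_apply, dyadicPiece_apply, FourierTransform.fourierInv_fourier_eq]
  congr 1
  ext x
  simp only [SchwartzMap.smulLeftCLM_apply_apply (hasTemperateGrowth_ofReal _), smul_eq_mul]
  by_cases hx : φ x = 0
  · simp [hx]
  · simp [h x hx]

/-- Bernstein's inequality between `L^p` and `L²` for `p ≤ 2`, for a frequency cut-off supported
in the ball of radius `R`. By duality it suffices to bound the smoothing operator
`ψ ↦ (χ ψ^∨)^` from `L²` to `L^{p'}` with `p' ≥ 2`, which follows by interpolation between
Plancherel's theorem and the Cauchy–Schwarz bound from `L²` to `L^∞`. -/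
theorem distLpNorm_two_le_distLpNorm {φ χ : 𝓢(EuclideanSpace ℝ (Fin d), ℝ)}
    (h : ∀ x, φ x ≠ 0 → χ x = 1) (hχ : ∀ x, |χ x| ≤ 1) {R : ℝ} (hR : 0 < R)
    (hχR : ∀ x, χ x ≠ 0 → ‖x‖ ≤ R) (f : 𝓢'(EuclideanSpace ℝ (Fin d), ℂ)) {p : ℝ≥0∞}
    [hp1 : Fact (1 ≤ p)] (hp : p ≤ 2) :
    distLpNorm 2 (dyadicPiece φ f) ≤
      ENNReal.ofReal (√(R ^ d * unitBallVolume d)) ^ (2 * p⁻¹.toReal - 1) *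
        distLpNorm p (dyadicPiece φ f) := by
  set V := ENNReal.ofReal (√(R ^ d * unitBallVolume d)) with hV
  have hp0 : p ≠ 0 := (lt_of_lt_of_le one_pos hp1.out).ne'
  have hpi : p⁻¹ ≤ 1 := ENNReal.inv_le_one.2 hp1.out
  have hpi2 : 2⁻¹ ≤ p⁻¹ := ENNReal.inv_le_inv.2 hp
  have hθ : 0 ≤ 2 * p⁻¹.toReal - 1 := by
    have := (ENNReal.toReal_le_toReal (by simp) (by simpa using hp0)).2 hpi2
    simp at this ⊢
    linarith
  rcases eq_or_ne (distLpNorm p (dyadicPiece φ f)) ∞ with htop | htop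
  · have hν := unitBallVolume_pos d
    have hV0 : V ≠ 0 := by rw [hV, Ne, ENNReal.ofReal_eq_zero, not_le]; positivity
    rw [htop, ENNReal.mul_top (ENNReal.rpow_pos (pos_iff_ne_zero.2 hV0) ENNReal.ofReal_ne_top).ne']
    exact le_top
  obtain ⟨g, hg, hgn⟩ := exists_of_distLpNorm_lt_top htop.lt_top
  rw [hgn]
  let q : ℝ≥0∞ := (1 - p⁻¹)⁻¹
  have : ENNReal.HolderConjugate p q := ENNReal.HolderConjugate.inv_one_sub_inv' hp1.out
  have : ENNReal.HolderConjugate q p := ENNReal.HolderConjugate.symm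
  have hq2 : 2 ≤ q := by
    rw [ENNReal.le_inv_iff_le_inv]
    refine tsub_le_iff_left.2 ?_
    rw [← ENNReal.inv_two_add_inv_two]
    gcongr
  have hqr : q⁻¹.toReal = 1 - p⁻¹.toReal := by
    simp only [q, inv_inv]
    rw [ENNReal.toReal_sub_of_le hpi (by simp), ENNReal.toReal_one]
  have hbound (ψ : 𝓢(EuclideanSpace ℝ (Fin d), ℂ)) :
      ‖dyadicPiece φ f ψ‖ₑ ≤ V ^ (2 * p⁻¹.toReal - 1) * ‖g‖ₑ * eLpNorm ψ 2 volume := by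
    set H := SchwartzMap.smulLeftCLM ℂ (fun x => ((χ x : ℝ) : ℂ)) (𝓕⁻ ψ) with hH
    have hHx (x) : H x = (χ x : ℂ) * (𝓕⁻ ψ : 𝓢(EuclideanSpace ℝ (Fin d), ℂ)) x := by
      simp [hH, SchwartzMap.smulLeftCLM_apply_apply (hasTemperateGrowth_ofReal χ)]
    have hle (x) : ‖H x‖ ≤ ‖(𝓕⁻ ψ : 𝓢(EuclideanSpace ℝ (Fin d), ℂ)) x‖ := by
      rw [hHx, norm_mul, Complex.norm_real]
      exact mul_le_of_le_one_left (norm_nonneg _) (hχ x)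
    have hle' (x) : ‖H x‖ₑ ≤ ‖(𝓕⁻ ψ : 𝓢(EuclideanSpace ℝ (Fin d), ℂ)) x‖ₑ :=
      enorm_le_iff_norm_le.2 (hle x)
    have h2 : eLpNorm (𝓕 H : 𝓢(EuclideanSpace ℝ (Fin d), ℂ)) 2 volume ≤ eLpNorm ψ 2 volume := by
      rw [eLpNorm_fourier_two, ← eLpNorm_fourierInv_two ψ]
      exact eLpNorm_mono hle
    have h3 : eLpNorm (𝓕 H : 𝓢(EuclideanSpace ℝ (Fin d), ℂ)) ∞ volume ≤
        V * eLpNorm ψ 2 volume := by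
      refine (eLpNorm_fourier_top_le H).trans ?_
      rw [eLpNorm_one_eq_lintegral_enorm, ← eLpNorm_fourierInv_two ψ]
      refine le_trans ?_ (setLIntegral_closedBall_le
        (𝓕⁻ ψ : 𝓢(EuclideanSpace ℝ (Fin d), ℂ)).continuous.aestronglyMeasurable hR.le)
      rw [← lintegral_indicator Metric.isClosed_closedBall.measurableSet]
      refine lintegral_mono fun x => ?_
      by_cases hx : χ x = 0
      · simp [hHx, hx]
      · rw [Set.indicator_of_mem (by simpa using hχR x hx)]
        exact hle' x
    have h4 : eLpNorm (𝓕 H : 𝓢(EuclideanSpace ℝ (Fin d), ℂ)) q volume ≤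
        V ^ (2 * p⁻¹.toReal - 1) * eLpNorm ψ 2 volume := by
      refine (eLpNorm_le_two_mul_top _ (SchwartzMap.eLpNorm_lt_top _ _ _).ne hq2).trans ?_
      have e1 : 1 - 2 * q⁻¹.toReal = 2 * p⁻¹.toReal - 1 := by rw [hqr]; ring
      have e2 : (0 : ℝ) ≤ 2 * q⁻¹.toReal := by positivity
      rw [e1]
      calc _ ≤ eLpNorm ψ 2 volume ^ (2 * q⁻¹.toReal) *
            (V * eLpNorm ψ 2 volume) ^ (2 * p⁻¹.toReal - 1) := by gcongr
        _ = V ^ (2 * p⁻¹.toReal - 1) * (eLpNorm ψ 2 volume ^ (2 * q⁻¹.toReal) *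
              eLpNorm ψ 2 volume ^ (2 * p⁻¹.toReal - 1)) := by
            rw [ENNReal.mul_rpow_of_nonneg _ _ hθ]; ring
        _ = _ := by
            rw [← ENNReal.rpow_add_of_nonneg _ _ e2 hθ, ← e1]
            simp
    rw [← dyadicPiece_apply_fourier h, ← hg]
    refine (norm_toTemperedDistribution_apply_le (q := q) g _).trans ?_
    rw [mul_right_comm]
    gcongr
  have hVt : V ^ (2 * p⁻¹.toReal - 1) ≠ ∞ := ENNReal.rpow_ne_top_of_nonneg hθ ENNReal.ofReal_ne_top
  have hC : V ^ (2 * p⁻¹.toReal - 1) * ‖g‖ₑ ≠ ∞ := ENNReal.mul_ne_top hVt enorm_ne_top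
  rw [← ENNReal.coe_toNNReal hC]
  refine distLpNorm_two_le_of_bound _ _ fun ψ => ?_
  have := hbound ψ
  rw [← ENNReal.coe_toNNReal hC] at this
  have h5 := ENNReal.toReal_mono
    (ENNReal.mul_ne_top ENNReal.coe_ne_top (ψ.eLpNorm_lt_top 2 volume).ne) this
  rw [ENNReal.toReal_mul, ← SchwartzMap.norm_toLp] at h5
  simpa using h5

end Bernstein

/-! ### Embeddings between Besov spaces -/

section Embeddings

variable {d : ℕ}

lemma ContinuouslyEmbeds.of_le {N M : 𝓢'(EuclideanSpace ℝ (Fin d), ℂ) → ℝ≥0∞} (C : ℝ≥0)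
    (h : ∀ f, N f < ∞ → M f ≤ C * N f) : ContinuouslyEmbeds N M :=
  ⟨fun f hf => (h f hf).trans_lt (ENNReal.mul_lt_top ENNReal.coe_lt_top hf), C, h⟩

lemma ContinuouslyEmbeds.trans {N M P : 𝓢'(EuclideanSpace ℝ (Fin d), ℂ) → ℝ≥0∞}
    (h₁ : ContinuouslyEmbeds N M) (h₂ : ContinuouslyEmbeds M P) : ContinuouslyEmbeds N P := by
  obtain ⟨h₁, C₁, hC₁⟩ := h₁
  obtain ⟨-, C₂, hC₂⟩ := h₂
  refine .of_le (C₂ * C₁) fun f hf => (hC₂ f (h₁ hf)).trans ?_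
  rw [ENNReal.coe_mul, mul_assoc]
  gcongr
  exact hC₁ f hf

/-- Bernstein's inequality for the dyadic pieces. -/
lemma IsDyadicResolution.distLpNorm_two_le {φ : ℕ → 𝓢(EuclideanSpace ℝ (Fin d), ℝ)}
    (hφ : IsDyadicResolution φ) (f : 𝓢'(EuclideanSpace ℝ (Fin d), ℂ)) {p : ℝ≥0∞} [Fact (1 ≤ p)]
    (hp : p ≤ 2) (j : ℕ) :
    distLpNorm 2 (dyadicPiece (φ j) f) ≤
      ENNReal.ofReal (√((2 ^ (j + 3)) ^ d * unitBallVolume d)) ^ (2 * p⁻¹.toReal - 1) *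
        distLpNorm p (dyadicPiece (φ j) f) := by
  -- The partial sum `φ_0 + ⋯ + φ_{j+2}` is `1` on the support of `φ_j`.
  have hsum (x) : (∑ k ∈ Finset.range (j + 3), φ k) x = ∑ k ∈ Finset.range (j + 3), φ k x :=
    sum_apply _ _ _
  have hnn (x) : 0 ≤ ∑ k ∈ Finset.range (j + 3), φ k x :=
    Finset.sum_nonneg fun k _ => hφ.nonneg k x
  refine distLpNorm_two_le_distLpNorm (χ := ∑ k ∈ Finset.range (j + 3), φ k) (fun x hx => ?_)
    (fun x => ?_) (by positivity) (fun x hx => ?_) f hp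
  · rw [hsum]
    refine hφ.sum_range_eq_one ((hφ.norm_le_of_ne_zero hx).trans_lt ?_)
    exact pow_lt_pow_right₀ (by norm_num) (by omega)
  · rw [hsum, abs_of_nonneg (hnn x)]
    exact sum_le_hasSum _ (fun k _ => hφ.nonneg k x) (hφ.hasSum_one x)
  · rw [hsum] at hx
    obtain ⟨k, hk, hk0⟩ := Finset.exists_ne_zero_of_sum_ne_zero hx
    refine (hφ.norm_le_of_ne_zero hk0).trans ?_
    exact pow_le_pow_right₀ (by norm_num) (by have := Finset.mem_range.1 hk; omega)

/-- The Besov embeddings that follow from Bernstein's inequality, which costs a factor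
`2^{jd(1/p - 1/2)}` on the `j`-th piece. -/
theorem continuouslyEmbeds_besovNorm_two_one {φ : ℕ → 𝓢(EuclideanSpace ℝ (Fin d), ℝ)}
    (hφ : IsDyadicResolution φ) {s α : ℝ} {p q : ℝ≥0∞} [hp1 : Fact (1 ≤ p)] (hp : p ≤ 2)
    (hq : 1 ≤ q) (h : s + d * p⁻¹.toReal < α ∨ (s + d * p⁻¹.toReal = α ∧ q = 1)) :
    ContinuouslyEmbeds (besovNorm φ α p q) (besovNorm φ (s + d / 2) 2 1) := by
  have hν := unitBallVolume_pos d
  set t := p⁻¹.toReal with ht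
  have h0 : (0 : ℝ) < 2 := by norm_num
  set K₀ : ℝ := ((2 : ℝ) ^ (3 * d) * unitBallVolume d) ^ (t - 1 / 2) with hK₀
  have hK₀pos : 0 < K₀ := by positivity
  have hpiece (f) (j : ℕ) :
      ENNReal.ofReal ((2 : ℝ) ^ ((s + d / 2) * j)) * distLpNorm 2 (dyadicPiece (φ j) f) ≤
        ENNReal.ofReal K₀ * (ENNReal.ofReal ((2 : ℝ) ^ ((s + d * t) * j)) *
          distLpNorm p (dyadicPiece (φ j) f)) := by
    refine (mul_le_mul_right (hφ.distLpNorm_two_le f hp j) _).trans_eq ?_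
    have hV : 0 < √((2 ^ (j + 3)) ^ d * unitBallVolume d) := by positivity
    rw [← ht, ENNReal.ofReal_rpow_of_pos hV, ← mul_assoc, ← mul_assoc, ← ENNReal.ofReal_mul (by positivity),
      ← ENNReal.ofReal_mul (by positivity)]
    congr 2
    have e1 : ((2 : ℝ) ^ (j + 3)) ^ d * unitBallVolume d =
        (2 : ℝ) ^ ((j : ℝ) * d) * (2 ^ (3 * d) * unitBallVolume d) := by
      rw [← mul_assoc, ← Real.rpow_natCast 2 (3 * d), ← Real.rpow_add h0, ← pow_mul,
        ← Real.rpow_natCast]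
      push_cast; ring_nf
    rw [e1, Real.sqrt_eq_rpow, ← Real.rpow_mul (by positivity),
      Real.mul_rpow (by positivity) (by positivity), ← Real.rpow_mul h0.le, ← mul_assoc,
      ← Real.rpow_add h0, mul_comm, hK₀]
    ring_nf
  rcases h with h | ⟨h, rfl⟩
  · set ε := α - (s + d * t) with hε
    have hεpos : 0 < ε := by linarith
    have hgeo : Summable fun j : ℕ => (2 : ℝ) ^ (-ε * j) := by
      have : (fun j : ℕ => (2 : ℝ) ^ (-ε * j)) = fun j : ℕ => ((2 : ℝ) ^ (-ε)) ^ j := by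
        ext j; rw [Real.rpow_mul h0.le, Real.rpow_natCast]
      rw [this]
      exact summable_geometric_of_lt_one (by positivity)
        (Real.rpow_lt_one_of_one_lt_of_neg (by norm_num) (by linarith))
    have hfin : ENNReal.ofReal K₀ * ∑' j : ℕ, ENNReal.ofReal ((2 : ℝ) ^ (-ε * j)) ≠ ∞ :=
      ENNReal.mul_ne_top ENNReal.ofReal_ne_top hgeo.tsum_ofReal_ne_top
    refine .of_le (ENNReal.ofReal K₀ * ∑' j : ℕ, ENNReal.ofReal ((2 : ℝ) ^ (-ε * j))).toNNReal
      fun f _ => ?_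
    rw [ENNReal.coe_toNNReal hfin, besovNorm_one, mul_assoc, ← ENNReal.tsum_mul_right,
      ← ENNReal.tsum_mul_left]
    refine ENNReal.tsum_le_tsum fun j => (hpiece f j).trans ?_
    refine mul_le_mul_right ?_ _
    refine le_trans (le_of_eq ?_) (mul_le_mul_right (le_besovNorm φ α p hq f j) _)
    rw [← mul_assoc, ← ENNReal.ofReal_mul (by positivity), ← Real.rpow_add h0, hε]
    congr 3; ring
  · refine .of_le K₀.toNNReal fun f _ => ?_
    rw [besovNorm_one, besovNorm_one, ← h, ← ENNReal.tsum_mul_left]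
    exact ENNReal.tsum_le_tsum fun j => hpiece f j

end Embeddings

/-! ### Test functions with Schwartz Fourier transform -/

section TestFunctions

variable {d : ℕ}

lemma barronNorm_fourierInv (s : ℝ) (F : 𝓢(EuclideanSpace ℝ (Fin d), ℂ)) :
    barronNorm s (𝓕⁻ (F : 𝓢'(EuclideanSpace ℝ (Fin d), ℂ))) =
      ∫⁻ ξ, ENNReal.ofReal (1 + ‖ξ‖ ^ s) * ‖F ξ‖ₑ := by
  have hF : ∀ g : Lp ℂ 1 (volume : Measure (EuclideanSpace ℝ (Fin d))),
      Lp.toTemperedDistribution g = 𝓕 (𝓕⁻ (F : 𝓢'(EuclideanSpace ℝ (Fin d), ℂ))) ↔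
        g = F.toLp 1 volume := by
    intro g
    rw [FourierTransform.fourier_fourierInv_eq, ← Lp.toTemperedDistribution_toLp_eq (p := 1)]
    exact (Lp_toTemperedDistribution_injective 1).eq_iff
  unfold barronNorm
  simp_rw [hF]
  rw [iInf_iInf_eq_left]
  refine lintegral_congr_ae ?_
  filter_upwards [F.coeFn_toLp 1 volume] with x hx
  rw [hx]

lemma dyadicPiece_fourierInv (φ : 𝓢(EuclideanSpace ℝ (Fin d), ℝ))
    (F : 𝓢(EuclideanSpace ℝ (Fin d), ℂ)) :
    dyadicPiece φ (𝓕⁻ (F : 𝓢'(EuclideanSpace ℝ (Fin d), ℂ))) =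
      ((𝓕⁻ (SchwartzMap.smulLeftCLM ℂ (fun x => ((φ x : ℝ) : ℂ)) F) :
        𝓢(EuclideanSpace ℝ (Fin d), ℂ)) : 𝓢'(EuclideanSpace ℝ (Fin d), ℂ)) := by
  rw [dyadicPiece, FourierTransform.fourier_fourierInv_eq,
    ← TemperedDistribution.fourierInv_toTemperedDistributionCLM_eq]
  congr 1
  ext ψ
  simp only [TemperedDistribution.smulLeftCLM_apply_apply,
    SchwartzMap.toTemperedDistributionCLM_apply_apply]
  refine integral_congr_ae (.of_forall fun x => ?_)
  simp only [SchwartzMap.smulLeftCLM_apply_apply (hasTemperateGrowth_ofReal φ), smul_eq_mul]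
  ring

lemma distLpNorm_dyadicPiece_fourierInv (φ : 𝓢(EuclideanSpace ℝ (Fin d), ℝ))
    {F H : 𝓢(EuclideanSpace ℝ (Fin d), ℂ)} (hH : ∀ x, H x = (φ x : ℂ) * F x)
    (p : ℝ≥0∞) [Fact (1 ≤ p)] :
    distLpNorm p (dyadicPiece φ (𝓕⁻ (F : 𝓢'(EuclideanSpace ℝ (Fin d), ℂ)))) =
      eLpNorm (𝓕⁻ H : 𝓢(EuclideanSpace ℝ (Fin d), ℂ)) p volume := by
  have : SchwartzMap.smulLeftCLM ℂ (fun x => ((φ x : ℝ) : ℂ)) F = H := by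
    ext x
    rw [SchwartzMap.smulLeftCLM_apply_apply (hasTemperateGrowth_ofReal φ), hH, smul_eq_mul]
  rw [dyadicPiece_fourierInv, this, distLpNorm_schwartz]

lemma eLpNorm_fourierInv_zero (p : ℝ≥0∞) :
    eLpNorm (𝓕⁻ (0 : 𝓢(EuclideanSpace ℝ (Fin d), ℂ)) : 𝓢(EuclideanSpace ℝ (Fin d), ℂ)) p volume =
      0 := by
  have : (𝓕⁻ (0 : 𝓢(EuclideanSpace ℝ (Fin d), ℂ))) = 0 :=
    map_zero (fourierInvCLM ℂ 𝓢(EuclideanSpace ℝ (Fin d), ℂ))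
  rw [this]
  exact eLpNorm_zero

lemma distLpNorm_dyadicPiece_eq_zero {φ : 𝓢(EuclideanSpace ℝ (Fin d), ℝ)}
    {F : 𝓢(EuclideanSpace ℝ (Fin d), ℂ)} (h : ∀ x, F x ≠ 0 → φ x = 0)
    (p : ℝ≥0∞) [Fact (1 ≤ p)] :
    distLpNorm p (dyadicPiece φ (𝓕⁻ (F : 𝓢'(EuclideanSpace ℝ (Fin d), ℂ)))) = 0 := by
  rw [distLpNorm_dyadicPiece_fourierInv φ (H := 0)]
  · exact eLpNorm_fourierInv_zero p
  · intro x
    by_cases hx : F x = 0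
    · simp [hx]
    · simp [h x hx]

/-- On low frequencies the Besov norm is an `L^p` norm, as only `φ_0`, which is `1` there,
contributes. -/
lemma besovNorm_fourierInv_of_low {φ : ℕ → 𝓢(EuclideanSpace ℝ (Fin d), ℝ)}
    (hφ : IsDyadicResolution φ) {F : 𝓢(EuclideanSpace ℝ (Fin d), ℂ)}
    (hF : ∀ x, F x ≠ 0 → ‖x‖ < 1) (α : ℝ) (p : ℝ≥0∞) [Fact (1 ≤ p)] {q : ℝ≥0∞} (hq : 1 ≤ q) :
    besovNorm φ α p q (𝓕⁻ (F : 𝓢'(EuclideanSpace ℝ (Fin d), ℂ))) =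
      eLpNorm (𝓕⁻ F : 𝓢(EuclideanSpace ℝ (Fin d), ℂ)) p volume := by
  have h0 : distLpNorm p (dyadicPiece (φ 0) (𝓕⁻ (F : 𝓢'(EuclideanSpace ℝ (Fin d), ℂ)))) =
      eLpNorm (𝓕⁻ F : 𝓢(EuclideanSpace ℝ (Fin d), ℂ)) p volume := by
    refine distLpNorm_dyadicPiece_fourierInv _ (fun x => ?_) p
    by_cases hx : F x = 0
    · simp [hx]
    · have := hφ.sum_range_eq_one (N := 0) (x := x) (by simpa using hF x hx)
      simp only [zero_add, Finset.range_one, Finset.sum_singleton] at this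
      simp [this]
  have h1 (j : ℕ) :
      distLpNorm p (dyadicPiece (φ (j + 1)) (𝓕⁻ (F : 𝓢'(EuclideanSpace ℝ (Fin d), ℂ)))) = 0 := by
    refine distLpNorm_dyadicPiece_eq_zero (fun x hx => ?_) p
    by_contra hne
    have h2 := hφ.le_norm_of_ne_zero hne
    have h3 : (1 : ℝ) ≤ 2 ^ j := one_le_pow₀ (by norm_num)
    linarith [hF x hx]
  unfold besovNorm
  split_ifs with h
  · refine le_antisymm (iSup_le fun j => ?_) (le_iSup_of_le 0 ?_)
    · rcases j with _ | j
      · simp [h0]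
      · simp [h1]
    · simp [h0]
  · have hq0 : 0 < q.toReal := ENNReal.toReal_pos (by positivity) h
    rw [tsum_eq_single 0]
    · simp only [h0, CharP.cast_eq_zero, mul_zero, Real.rpow_zero, ENNReal.ofReal_one, one_mul]
      rw [← ENNReal.rpow_mul, mul_one_div_cancel hq0.ne', ENNReal.rpow_one]
    · intro j hj
      obtain ⟨k, rfl⟩ := Nat.exists_eq_succ_of_ne_zero hj
      simp [h1, hq0]

lemma fourierInv_apply_of_comp_smul {F H : 𝓢(EuclideanSpace ℝ (Fin d), ℂ)} {c : ℝ} (hc : 0 < c)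
    (h : ∀ x, H x = F (c • x)) (x : EuclideanSpace ℝ (Fin d)) :
    (𝓕⁻ H : 𝓢(EuclideanSpace ℝ (Fin d), ℂ)) x =
      ((c ^ d)⁻¹ : ℝ) • (𝓕⁻ F : 𝓢(EuclideanSpace ℝ (Fin d), ℂ)) (c⁻¹ • x) := by
  rw [SchwartzMap.fourierInv_coe, SchwartzMap.fourierInv_coe, Real.fourierInv_eq,
    Real.fourierInv_eq]
  have h1 := Measure.integral_comp_smul volume
    (fun v : EuclideanSpace ℝ (Fin d) => Real.fourierChar (inner ℝ v (c⁻¹ • x)) • F v) c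
  rw [finrank_euclideanSpace_fin, abs_of_pos (by positivity)] at h1
  rw [← h1]
  refine integral_congr_ae (.of_forall fun v => ?_)
  simp only [h, real_inner_smul_left, real_inner_smul_right]
  rw [← mul_assoc, inv_mul_cancel₀ hc.ne', one_mul]

lemma eLpNorm_fourierInv_of_comp_smul {F H : 𝓢(EuclideanSpace ℝ (Fin d), ℂ)} {c : ℝ} (hc : 0 < c)
    (h : ∀ x, H x = F (c • x)) (p : ℝ≥0∞) :
    eLpNorm (𝓕⁻ H : 𝓢(EuclideanSpace ℝ (Fin d), ℂ)) p volume =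
      ENNReal.ofReal (c ^ (d * (p⁻¹.toReal - 1))) *
        eLpNorm (𝓕⁻ F : 𝓢(EuclideanSpace ℝ (Fin d), ℂ)) p volume := by
  have h1 : ⇑(𝓕⁻ H : 𝓢(EuclideanSpace ℝ (Fin d), ℂ)) = ((c ^ d)⁻¹ : ℝ) •
      fun x => (𝓕⁻ F : 𝓢(EuclideanSpace ℝ (Fin d), ℂ)) (c⁻¹ • x) :=
    funext fun x => fourierInv_apply_of_comp_smul hc h x
  rw [h1, eLpNorm_const_smul, eLpNorm_comp_smul (SchwartzMap.continuous _) (inv_pos.2 hc),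
    ← mul_assoc]
  congr 1
  rw [Real.enorm_of_nonneg (by positivity), ← ENNReal.ofReal_mul (by positivity)]
  congr 1
  rw [Real.inv_rpow hc.le, Real.rpow_neg hc.le, inv_inv, ← Real.rpow_natCast, ← Real.rpow_neg hc.le,
    ← Real.rpow_add hc, finrank_euclideanSpace_fin]
  ring_nf

/-- The dilate `ξ ↦ F (c ξ)` of a Schwartz function. -/
noncomputable def dilate (F : 𝓢(EuclideanSpace ℝ (Fin d), ℂ)) {c : ℝ} (hc : 0 < c) :
    𝓢(EuclideanSpace ℝ (Fin d), ℂ) :=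
  SchwartzMap.compCLMOfContinuousLinearEquiv ℂ
    (ContinuousLinearEquiv.smulLeft (Units.mk0 c hc.ne')) F

lemma dilate_apply (F : 𝓢(EuclideanSpace ℝ (Fin d), ℂ)) {c : ℝ} (hc : 0 < c)
    (x : EuclideanSpace ℝ (Fin d)) : dilate F hc x = F (c • x) := rfl

/-- A smooth bump function, as a complex valued Schwartz function. -/
noncomputable def schwartzBump {x₀ : EuclideanSpace ℝ (Fin d)} (b : ContDiffBump x₀) :
    𝓢(EuclideanSpace ℝ (Fin d), ℂ) :=
  HasCompactSupport.toSchwartzMap (f := fun x => ((b x : ℝ) : ℂ))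
    (b.hasCompactSupport.comp_left (g := fun t : ℝ => (t : ℂ)) rfl)
    (Complex.ofRealCLM.contDiff.comp b.contDiff)

lemma schwartzBump_apply {x₀ : EuclideanSpace ℝ (Fin d)} (b : ContDiffBump x₀)
    (x : EuclideanSpace ℝ (Fin d)) : schwartzBump b x = ((b x : ℝ) : ℂ) := rfl

lemma norm_sub_lt_of_schwartzBump_ne_zero {x₀ : EuclideanSpace ℝ (Fin d)} {b : ContDiffBump x₀}
    {x : EuclideanSpace ℝ (Fin d)} (h : schwartzBump b x ≠ 0) : ‖x - x₀‖ < b.rOut := by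
  rw [schwartzBump_apply, Complex.ofReal_ne_zero] at h
  have : x ∈ Function.support b := h
  rw [b.support_eq] at this
  simpa [dist_eq_norm] using this

lemma eLpNorm_fourierInv_schwartzBump_ne_zero {x₀ : EuclideanSpace ℝ (Fin d)} (b : ContDiffBump x₀) {p : ℝ≥0∞}
    (hp : p ≠ 0) :
    eLpNorm (𝓕⁻ (schwartzBump b) : 𝓢(EuclideanSpace ℝ (Fin d), ℂ)) p volume ≠ 0 := by
  intro h
  rw [eLpNorm_eq_zero_iff (SchwartzMap.continuous _).aestronglyMeasurable hp] at h
  have h0 := (SchwartzMap.continuous _).ae_eq_iff_eq volume continuous_zero |>.1 h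
  have h1 : (𝓕⁻ (schwartzBump b) : 𝓢(EuclideanSpace ℝ (Fin d), ℂ)) = 0 := by
    ext x; exact congrFun h0 x
  have h2 : schwartzBump b = 0 := by
    rw [← FourierTransform.fourier_fourierInv_eq (E := 𝓢(EuclideanSpace ℝ (Fin d), ℂ))
      (F := 𝓢(EuclideanSpace ℝ (Fin d), ℂ)) (schwartzBump b), h1]
    exact map_zero (fourierCLM ℂ 𝓢(EuclideanSpace ℝ (Fin d), ℂ))
  have h3 := congrArg (fun F => F x₀) h2
  simp [schwartzBump_apply, b.one_of_mem_closedBall (Metric.mem_closedBall_self b.rIn_pos.le)] at h3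

end TestFunctions

/-! ### Low frequencies: the integrability exponents of the embeddings -/

section LowFrequency

variable {d : ℕ}

/-- The frequency-localized chirp `e^{-b |ξ|²} η(ξ)`, with `η` a bump function. -/
noncomputable def chirp {x₀ : EuclideanSpace ℝ (Fin d)} (η : ContDiffBump x₀) (b : ℂ) :
    𝓢(EuclideanSpace ℝ (Fin d), ℂ) :=
  HasCompactSupport.toSchwartzMap
    (f := fun x => Complex.exp (-b * (‖x‖ : ℂ) ^ 2) * ((η x : ℝ) : ℂ))
    ((η.hasCompactSupport.comp_left (g := fun t : ℝ => (t : ℂ)) rfl).mul_left) (by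
      have h1 : ContDiff ℝ (⊤ : ℕ∞) fun x : EuclideanSpace ℝ (Fin d) =>
          ((‖x‖ ^ 2 : ℝ) : ℂ) := Complex.ofRealCLM.contDiff.comp (contDiff_norm_sq ℝ)
      have h2 : ContDiff ℝ (⊤ : ℕ∞) fun x => ((η x : ℝ) : ℂ) :=
        Complex.ofRealCLM.contDiff.comp η.contDiff
      simp only [Complex.ofReal_pow] at h1
      exact (contDiff_const.mul h1).cexp.mul h2)

lemma chirp_apply {x₀ : EuclideanSpace ℝ (Fin d)} (η : ContDiffBump x₀) (b : ℂ)
    (x : EuclideanSpace ℝ (Fin d)) :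
    chirp η b x = Complex.exp (-b * (‖x‖ : ℂ) ^ 2) * schwartzBump η x := rfl

lemma norm_chirp_apply {x₀ : EuclideanSpace ℝ (Fin d)} (η : ContDiffBump x₀) (b : ℂ)
    (x : EuclideanSpace ℝ (Fin d)) :
    ‖chirp η b x‖ = Real.exp (-b.re * ‖x‖ ^ 2) * η x := by
  rw [chirp_apply, norm_mul, Complex.norm_exp, schwartzBump_apply, Complex.norm_real,
    Real.norm_of_nonneg η.nonneg]
  congr 2
  rw [← Complex.ofReal_pow, Complex.re_mul_ofReal, Complex.neg_re]

/-- The inverse Fourier transform of a chirp is small in `L^∞`: it is the convolution of the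
integrable function `η^∨` with the transform of a complex Gaussian, which is bounded by
`(π / |b|)^{d/2}`. -/
lemma norm_fourierInv_chirp_le {x₀ : EuclideanSpace ℝ (Fin d)} (η : ContDiffBump x₀) {b : ℂ}
    (hb : 0 < b.re) (x : EuclideanSpace ℝ (Fin d)) :
    ‖(𝓕⁻ (chirp η b) : 𝓢(EuclideanSpace ℝ (Fin d), ℂ)) x‖ ≤
      (∫ y, ‖(𝓕⁻ (schwartzBump η) : 𝓢(EuclideanSpace ℝ (Fin d), ℂ)) y‖) *
        (Real.pi / ‖b‖) ^ ((d : ℝ) / 2) := by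
  set k : 𝓢(EuclideanSpace ℝ (Fin d), ℂ) := 𝓕⁻ (schwartzBump η) with hk
  set G : EuclideanSpace ℝ (Fin d) → ℂ := fun v => Complex.exp (-b * (‖v‖ : ℂ) ^ 2) with hG
  have hGi : Integrable G := by
    have := GaussianFourier.integrable_cexp_neg_mul_sq_norm_add hb 0 (0 : EuclideanSpace ℝ (Fin d))
    simpa [hG] using this
  have hki : Integrable (fun y => k (y + x)) := k.integrable.comp_add_right x
  have hkF : 𝓕 (k : EuclideanSpace ℝ (Fin d) → ℂ) = schwartzBump η := by
    rw [← SchwartzMap.fourier_coe, hk, FourierTransform.fourier_fourierInv_eq]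
  have h1 : (𝓕⁻ (chirp η b) : 𝓢(EuclideanSpace ℝ (Fin d), ℂ)) x =
      ∫ y, k (y + x) • 𝓕 G y := by
    have h2 := VectorFourier.integral_fourierIntegral_smul_eq_flip (μ := volume) (ν := volume)
      (L := innerₗ (EuclideanSpace ℝ (Fin d))) Real.continuous_fourierChar
      (by simpa using continuous_inner (𝕜 := ℝ) (E := EuclideanSpace ℝ (Fin d))) hki hGi
    have h3 := VectorFourier.fourierIntegral_comp_add_right Real.fourierChar volume
      (innerₗ (EuclideanSpace ℝ (Fin d))) k x
    have h4 : (fun y => k (y + x)) = k ∘ fun y => y + x := rfl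
    rw [h4, h3] at h2
    have h5 : (innerₗ (EuclideanSpace ℝ (Fin d))).flip = innerₗ (EuclideanSpace ℝ (Fin d)) := by
      ext x y; simp
    rw [h5] at h2
    rw [SchwartzMap.fourierInv_coe, Real.fourierInv_eq]
    refine Eq.trans (integral_congr_ae (.of_forall fun v => ?_)) h2
    have h6 := congrFun hkF v
    change Real.fourierChar (inner ℝ v x) • chirp η b v =
      (Real.fourierChar (inner ℝ x v) • 𝓕 (k : EuclideanSpace ℝ (Fin d) → ℂ) v) • G v
    rw [h6, chirp_apply, real_inner_comm, smul_assoc, smul_eq_mul (schwartzBump η v), mul_comm]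
  have hFG (y) : ‖𝓕 G y‖ ≤ (Real.pi / ‖b‖) ^ ((d : ℝ) / 2) := by
    rw [hG, fourier_gaussian_innerProductSpace hb, norm_mul, finrank_euclideanSpace_fin]
    have e1 : ((d : ℂ) / 2) = (((d : ℝ) / 2 : ℝ) : ℂ) := by push_cast; ring
    rw [e1, Complex.norm_cpow_real, norm_div, Complex.norm_real,
      Real.norm_of_nonneg Real.pi_pos.le]
    refine mul_le_of_le_one_right (by positivity) ?_
    rw [Complex.norm_exp, Real.exp_le_one_iff]
    have e2 : -(Real.pi : ℂ) ^ 2 * (‖y‖ : ℂ) ^ 2 / b =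
        ((-(Real.pi ^ 2 * ‖y‖ ^ 2) : ℝ) : ℂ) * b⁻¹ := by push_cast; ring
    rw [e2, Complex.re_ofReal_mul, Complex.inv_re]
    have : 0 ≤ b.re / Complex.normSq b := div_nonneg hb.le (Complex.normSq_nonneg _)
    have : 0 ≤ Real.pi ^ 2 * ‖y‖ ^ 2 := by positivity
    nlinarith
  rw [h1]
  calc _ ≤ ∫ y, ‖k (y + x)‖ * (Real.pi / ‖b‖) ^ ((d : ℝ) / 2) := by
        refine norm_integral_le_of_norm_le (hki.norm.mul_const _) (.of_forall fun y => ?_)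
        rw [norm_smul]
        gcongr
        exact hFG y
    _ = _ := by
        rw [integral_mul_const, integral_add_right_eq_self (fun y => ‖k y‖)]

/-- If `B^α_{p,q}` embeds into a spectral Barron space then `p ≤ 2`: the chirps `e^{-(1 + in)|ξ|²} η(ξ)`
have the same modulus for all `n`, hence the same Barron norm, while the `L^p` norms of their inverse
Fourier transforms tend to zero for `p > 2`, by interpolation between `L²` and `L^∞`. -/
theorem le_two_of_continuouslyEmbeds (hd : 1 ≤ d) {φ : ℕ → 𝓢(EuclideanSpace ℝ (Fin d), ℝ)}
    (hφ : IsDyadicResolution φ) {s α : ℝ} {p q : ℝ≥0∞} [Fact (1 ≤ p)] (hq : 1 ≤ q)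
    (h : ContinuouslyEmbeds (besovNorm φ α p q) (barronNorm s)) : p ≤ 2 := by
  by_contra! hp
  obtain ⟨-, C, hC⟩ := h
  let η : ContDiffBump (0 : EuclideanSpace ℝ (Fin d)) := ⟨1 / 4, 1 / 2, by norm_num, by norm_num⟩
  let b : ℕ → ℂ := fun n => 1 + n * Complex.I
  have hbre (n) : (b n).re = 1 := by simp [b]
  have hbn (n : ℕ) : (n : ℝ) ≤ ‖b n‖ := by
    have := Complex.abs_im_le_norm (b n)
    simpa [b] using this
  let F : ℕ → 𝓢(EuclideanSpace ℝ (Fin d), ℂ) := fun n => chirp η (b n)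
  let f : ℕ → 𝓢'(EuclideanSpace ℝ (Fin d), ℂ) := fun n => 𝓕⁻ (F n : 𝓢'(EuclideanSpace ℝ (Fin d), ℂ))
  have hnorm (n x) : ‖F n x‖ = ‖F 0 x‖ := by
    simp only [F, norm_chirp_apply, hbre]
  have hlow (n x) (hx : F n x ≠ 0) : ‖x‖ < 1 := by
    have h1 : schwartzBump η x ≠ 0 := by
      intro h0
      exact hx (by simp [F, chirp_apply, h0])
    have h2 : ‖x - 0‖ < 1 / 2 := norm_sub_lt_of_schwartzBump_ne_zero h1
    rw [sub_zero] at h2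
    linarith
  have hbesov (n) : besovNorm φ α p q (f n) =
      eLpNorm (𝓕⁻ (F n) : 𝓢(EuclideanSpace ℝ (Fin d), ℂ)) p volume :=
    besovNorm_fourierInv_of_low hφ (hlow n) α p hq
  have hbarron (n) : eLpNorm (F 0) 1 volume ≤ barronNorm s (f n) := by
    rw [barronNorm_fourierInv, eLpNorm_one_eq_lintegral_enorm]
    refine lintegral_mono fun ξ => ?_
    rw [← ofReal_norm, ← hnorm n, ofReal_norm]
    refine le_mul_of_one_le_left (by simp) ?_
    rw [ENNReal.one_le_ofReal]
    have : 0 ≤ ‖ξ‖ ^ s := by positivity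
    linarith
  have hpos : eLpNorm (F 0) 1 volume ≠ 0 := by
    intro h0
    rw [eLpNorm_eq_zero_iff (SchwartzMap.continuous _).aestronglyMeasurable one_ne_zero] at h0
    have h1 := congrFun ((SchwartzMap.continuous _).ae_eq_iff_eq volume continuous_zero |>.1 h0) 0
    have h2 : ‖F 0 0‖ = 0 := by rw [h1]; simp
    simp [F, norm_chirp_apply, η.one_of_mem_closedBall (Metric.mem_closedBall_self η.rIn_pos.le)]
      at h2
  have hθ : 0 < 1 - 2 * p⁻¹.toReal := by
    have h1 : p⁻¹ < 2⁻¹ := ENNReal.inv_lt_inv.2 hp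
    have h2 := (ENNReal.toReal_lt_toReal (h1.trans (by simp)).ne (by simp)).2 h1
    simp at h2 ⊢
    linarith
  set A := ∫ y, ‖(𝓕⁻ (schwartzBump η) : 𝓢(EuclideanSpace ℝ (Fin d), ℂ)) y‖
  have hlim0 : Tendsto (fun n : ℕ => A * (Real.pi / n) ^ ((d : ℝ) / 2)) atTop (𝓝 0) := by
    have hd' : 0 < (d : ℝ) / 2 := by positivity
    have h1 : Tendsto (fun n : ℕ => Real.pi / (n : ℝ)) atTop (𝓝 0) :=
      tendsto_const_div_atTop_nhds_zero_nat _
    have h2 := (h1.rpow_const (p := (d : ℝ) / 2) (Or.inr hd'.le)).const_mul A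
    rwa [Real.zero_rpow hd'.ne', mul_zero] at h2
  have hub (n : ℕ) (hn : 1 ≤ n) : besovNorm φ α p q (f n) ≤
      eLpNorm (F 0) 2 volume ^ (2 * p⁻¹.toReal) *
        ENNReal.ofReal (A * (Real.pi / n) ^ ((d : ℝ) / 2)) ^ (1 - 2 * p⁻¹.toReal) := by
    rw [hbesov]
    refine (eLpNorm_le_two_mul_top _ (SchwartzMap.eLpNorm_lt_top _ _ _).ne hp.le).trans ?_
    have e1 : eLpNorm (𝓕⁻ (F n) : 𝓢(EuclideanSpace ℝ (Fin d), ℂ)) 2 volume =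
        eLpNorm (F 0) 2 volume := by
      rw [eLpNorm_fourierInv_two]
      exact eLpNorm_congr_norm_ae (.of_forall (hnorm n))
    have e2 : eLpNorm (𝓕⁻ (F n) : 𝓢(EuclideanSpace ℝ (Fin d), ℂ)) ∞ volume ≤
        ENNReal.ofReal (A * (Real.pi / n) ^ ((d : ℝ) / 2)) := by
      refine eLpNormEssSup_le_of_ae_enorm_bound (.of_forall fun x => ?_)
      rw [← ofReal_norm]
      refine ENNReal.ofReal_le_ofReal
        ((norm_fourierInv_chirp_le η (by rw [hbre]; exact one_pos) x).trans ?_)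
      have hn0 : (0 : ℝ) < n := by exact_mod_cast hn
      gcongr
      exact hbn n
    rw [e1]
    gcongr
  have hlim : Tendsto (fun n : ℕ => (C : ℝ≥0∞) * (eLpNorm (F 0) 2 volume ^ (2 * p⁻¹.toReal) *
        ENNReal.ofReal (A * (Real.pi / n) ^ ((d : ℝ) / 2)) ^ (1 - 2 * p⁻¹.toReal)))
      atTop (𝓝 0) := by
    have h1 := (ENNReal.tendsto_ofReal hlim0).ennrpow_const (1 - 2 * p⁻¹.toReal)
    rw [ENNReal.ofReal_zero, ENNReal.zero_rpow_of_pos hθ] at h1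
    have h2 := ENNReal.Tendsto.const_mul h1 (Or.inr (ENNReal.rpow_ne_top_of_nonneg
      (by positivity : 0 ≤ 2 * p⁻¹.toReal) ((F 0).eLpNorm_lt_top 2 volume).ne))
    have h3 := ENNReal.Tendsto.const_mul h2 (Or.inr (ENNReal.coe_ne_top (r := C)))
    simpa using h3
  refine hpos (le_antisymm (ge_of_tendsto hlim ?_) zero_le)
  filter_upwards [eventually_ge_atTop 1] with n hn
  refine (hbarron n).trans ((hC (f n) ?_).trans (by gcongr; exact hub n hn))
  rw [hbesov]
  exact SchwartzMap.eLpNorm_lt_top _ _ _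

/-- If a spectral Barron space embeds into `B^α_{p,q}` then `p = ∞`: concentrating a bump `η((n+1) ξ)`
at the origin, the Barron norm is at most of order `n^{-d}`, and the `L^p` norm of the inverse Fourier
transform is of order `n^{d/p - d}`. -/
theorem eq_top_of_continuouslyEmbeds (hd : 1 ≤ d) {φ : ℕ → 𝓢(EuclideanSpace ℝ (Fin d), ℝ)}
    (hφ : IsDyadicResolution φ) {s α : ℝ} (hs : 0 ≤ s) {p q : ℝ≥0∞} [hp1 : Fact (1 ≤ p)]
    (hq : 1 ≤ q) (h : ContinuouslyEmbeds (barronNorm s) (besovNorm φ α p q)) : p = ∞ := by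
  by_contra hp
  obtain ⟨-, C, hC⟩ := h
  let η : ContDiffBump (0 : EuclideanSpace ℝ (Fin d)) := ⟨1 / 4, 1 / 2, by norm_num, by norm_num⟩
  have hp0 : p ≠ 0 := (lt_of_lt_of_le one_pos hp1.out).ne'
  have ht : 0 < p⁻¹.toReal := ENNReal.toReal_pos (by simpa using hp) (by simpa using hp0)
  have hcpos (n : ℕ) : (0 : ℝ) < (n : ℝ) + 1 := by positivity
  let F : ℕ → 𝓢(EuclideanSpace ℝ (Fin d), ℂ) := fun n =>
    dilate (schwartzBump η) (hcpos n)
  have hF (n x) : F n x = schwartzBump η (((n : ℝ) + 1) • x) := rfl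
  let f : ℕ → 𝓢'(EuclideanSpace ℝ (Fin d), ℂ) := fun n => 𝓕⁻ (F n : 𝓢'(EuclideanSpace ℝ (Fin d), ℂ))
  have hlow (n x) (hx : F n x ≠ 0) : ‖x‖ < 1 := by
    rw [hF] at hx
    have h2 : ‖((n : ℝ) + 1) • x - 0‖ < 1 / 2 := norm_sub_lt_of_schwartzBump_ne_zero hx
    rw [sub_zero, norm_smul, Real.norm_of_nonneg (hcpos n).le] at h2
    have : ‖x‖ ≤ ((n : ℝ) + 1) * ‖x‖ :=
      le_mul_of_one_le_left (norm_nonneg x) (by linarith [Nat.cast_nonneg (α := ℝ) n])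
    linarith
  have hbesov (n) : besovNorm φ α p q (f n) =
      ENNReal.ofReal (((n : ℝ) + 1) ^ (d * (p⁻¹.toReal - 1))) *
        eLpNorm (𝓕⁻ (schwartzBump η) : 𝓢(EuclideanSpace ℝ (Fin d), ℂ)) p volume := by
    rw [← eLpNorm_fourierInv_of_comp_smul (hcpos n) (hF n)]
    exact besovNorm_fourierInv_of_low hφ (hlow n) α p hq
  have hbarron (n) : barronNorm s (f n) ≤
      2 * (ENNReal.ofReal (((n : ℝ) + 1) ^ (-(d : ℝ))) * eLpNorm (schwartzBump η) 1 volume) := by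
    have h1 := eLpNorm_comp_smul (μ := volume) (schwartzBump η).continuous (hcpos n) 1
    simp only [finrank_euclideanSpace_fin, inv_one, ENNReal.toReal_one, mul_one] at h1
    rw [barronNorm_fourierInv, ← h1, eLpNorm_one_eq_lintegral_enorm,
      ← lintegral_const_mul' _ _ (by simp)]
    refine lintegral_mono fun ξ => ?_
    rw [hF]
    by_cases hx : F n ξ = 0
    · rw [hF] at hx; simp [hx]
    · gcongr
      refine ENNReal.ofReal_le_of_le_toReal ?_
      have := Real.rpow_le_one (norm_nonneg ξ) (hlow n ξ hx).le hs
      simp; linarith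
  set P := eLpNorm (𝓕⁻ (schwartzBump η) : 𝓢(EuclideanSpace ℝ (Fin d), ℂ)) p volume with hP
  set A := eLpNorm (schwartzBump η) 1 volume with hA
  have hPpos : 0 < P.toReal :=
    ENNReal.toReal_pos (eLpNorm_fourierInv_schwartzBump_ne_zero η hp0) (SchwartzMap.eLpNorm_lt_top _ _ _).ne
  have hAtop : A ≠ ∞ := ((schwartzBump η).eLpNorm_lt_top 1 volume).ne
  have key (n : ℕ) : ((n : ℝ) + 1) ^ (d * p⁻¹.toReal) * P.toReal ≤ (C * (2 * A)).toReal := by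
    have h1 : besovNorm φ α p q (f n) ≤ C * (2 * (ENNReal.ofReal (((n : ℝ) + 1) ^ (-(d : ℝ))) * A)) :=
      (hC (f n) ((hbarron n).trans_lt (by finiteness))).trans (by gcongr; exact hbarron n)
    rw [hbesov] at h1
    have h2 : ENNReal.ofReal (((n : ℝ) + 1) ^ (d * p⁻¹.toReal)) * P ≤ C * (2 * A) := by
      have e1 : ((n : ℝ) + 1) ^ (d * p⁻¹.toReal) =
          ((n : ℝ) + 1) ^ (d : ℝ) * ((n : ℝ) + 1) ^ (d * (p⁻¹.toReal - 1)) := by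
        rw [← Real.rpow_add (hcpos n)]; ring_nf
      have hcd : (0 : ℝ) < ((n : ℝ) + 1) ^ (d : ℝ) := Real.rpow_pos_of_pos (hcpos n) _
      calc _ = ENNReal.ofReal (((n : ℝ) + 1) ^ (d : ℝ)) *
            (ENNReal.ofReal (((n : ℝ) + 1) ^ (d * (p⁻¹.toReal - 1))) * P) := by
              rw [e1, ENNReal.ofReal_mul hcd.le, mul_assoc]
        _ ≤ ENNReal.ofReal (((n : ℝ) + 1) ^ (d : ℝ)) *
            (C * (2 * (ENNReal.ofReal (((n : ℝ) + 1) ^ (-(d : ℝ))) * A))) := by gcongr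
        _ = (ENNReal.ofReal (((n : ℝ) + 1) ^ (d : ℝ)) *
            ENNReal.ofReal (((n : ℝ) + 1) ^ (-(d : ℝ)))) * (C * (2 * A)) := by ring
        _ = _ := by
            rw [← ENNReal.ofReal_mul hcd.le, ← Real.rpow_add (hcpos n)]
            simp
    have h3 := ENNReal.toReal_mono (by finiteness) h2
    rwa [ENNReal.toReal_mul, ENNReal.toReal_ofReal (Real.rpow_nonneg (hcpos n).le _)] at h3
  have hdt : 0 < d * p⁻¹.toReal := by positivity
  have hlim : Tendsto (fun n : ℕ => ((n : ℝ) + 1) ^ (d * p⁻¹.toReal) * P.toReal) atTop atTop :=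
    ((tendsto_rpow_atTop hdt).comp
      (tendsto_natCast_atTop_atTop.atTop_add tendsto_const_nhds)).atTop_mul_const hPpos
  obtain ⟨n, hn⟩ := (hlim.eventually_gt_atTop (C * (2 * A)).toReal).exists
  exact absurd (key n) (not_le.2 hn)

end LowFrequency

/-! ### Bumps at dyadic frequencies -/

section DyadicBumps

variable {d : ℕ}

lemma ofReal_two_rpow_mul (a b : ℝ) :
    ENNReal.ofReal ((2 : ℝ) ^ a) * ENNReal.ofReal ((2 : ℝ) ^ b) =
      ENNReal.ofReal ((2 : ℝ) ^ (a + b)) := by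
  rw [← ENNReal.ofReal_mul (by positivity), ← Real.rpow_add two_pos]

/-- The dilate `F (2^{-j} ξ)`, living at frequencies `|ξ| ∼ 2^j` if `F` lives at `|ξ| ∼ 1`. -/
noncomputable def dyadicDilate (F : 𝓢(EuclideanSpace ℝ (Fin d), ℂ)) (j : ℕ) :
    𝓢(EuclideanSpace ℝ (Fin d), ℂ) :=
  dilate F (Real.rpow_pos_of_pos two_pos (-(j : ℝ)))

lemma dyadicDilate_apply (F : 𝓢(EuclideanSpace ℝ (Fin d), ℂ)) (j : ℕ)
    (x : EuclideanSpace ℝ (Fin d)) :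
    dyadicDilate F j x = F ((2 : ℝ) ^ (-(j : ℝ)) • x) := rfl

/-- `F` is supported in the annulus `3/4 < |ξ| < 5/4`. -/
def IsAnnular (F : 𝓢(EuclideanSpace ℝ (Fin d), ℂ)) : Prop :=
  ∀ x, F x ≠ 0 → 3 / 4 < ‖x‖ ∧ ‖x‖ < 5 / 4

lemma IsAnnular.norm_bounds {F : 𝓢(EuclideanSpace ℝ (Fin d), ℂ)} (hF : IsAnnular F) {j : ℕ}
    {x : EuclideanSpace ℝ (Fin d)} (hx : dyadicDilate F j x ≠ 0) :
    3 / 4 * 2 ^ j < ‖x‖ ∧ ‖x‖ < 5 / 4 * 2 ^ j := by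
  have h1 := hF ((2 : ℝ) ^ (-(j : ℝ)) • x) hx
  have h2 : (0 : ℝ) < 2 ^ j := by positivity
  rwa [norm_smul, Real.norm_of_nonneg (by positivity), Real.rpow_neg two_pos.le,
    Real.rpow_natCast, inv_mul_eq_div, lt_div_iff₀ h2, div_lt_iff₀ h2] at h1

/-- Only neighbouring members of the resolution meet a dilated annulus. -/
lemma IsAnnular.close_of_ne_zero {φ : ℕ → 𝓢(EuclideanSpace ℝ (Fin d), ℝ)}
    (hφ : IsDyadicResolution φ) {F : 𝓢(EuclideanSpace ℝ (Fin d), ℂ)} (hF : IsAnnular F) {j k : ℕ}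
    {x : EuclideanSpace ℝ (Fin d)} (hx : dyadicDilate F j x ≠ 0) (hk : φ k x ≠ 0) :
    k ≤ j + 1 ∧ j ≤ k + 1 := by
  obtain ⟨h1, h2⟩ := hF.norm_bounds hx
  constructor
  · by_contra! h
    obtain ⟨i, rfl⟩ : ∃ i, k = i + 1 := ⟨k - 1, by omega⟩
    have h3 := hφ.le_norm_of_ne_zero hk
    have h4 : (2 : ℝ) ^ (j + 1) ≤ 2 ^ i := pow_le_pow_right₀ one_le_two (by omega)
    have h5 : (0 : ℝ) < 2 ^ j := by positivity
    rw [pow_succ] at h4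
    linarith
  · by_contra! h
    have h3 := hφ.norm_le_of_ne_zero hk
    have h4 : (2 : ℝ) ^ (k + 1 + 1) ≤ 2 ^ j := pow_le_pow_right₀ one_le_two (by omega)
    rw [pow_succ] at h4
    have h5 : (0 : ℝ) < 2 ^ (k + 1) := by positivity
    linarith

lemma eLpNorm_fourierInv_dyadicDilate (F : 𝓢(EuclideanSpace ℝ (Fin d), ℂ)) (j : ℕ) (p : ℝ≥0∞) :
    eLpNorm (𝓕⁻ (dyadicDilate F j) : 𝓢(EuclideanSpace ℝ (Fin d), ℂ)) p volume =
      ENNReal.ofReal ((2 : ℝ) ^ (j * (d * (1 - p⁻¹.toReal)))) *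
        eLpNorm (𝓕⁻ F : 𝓢(EuclideanSpace ℝ (Fin d), ℂ)) p volume := by
  rw [eLpNorm_fourierInv_of_comp_smul (Real.rpow_pos_of_pos two_pos (-(j : ℝ)))
    (dyadicDilate_apply F j), ← Real.rpow_mul two_pos.le]
  ring_nf

lemma eLpNorm_one_dyadicDilate (F : 𝓢(EuclideanSpace ℝ (Fin d), ℂ)) (j : ℕ) :
    eLpNorm (dyadicDilate F j) 1 volume =
      ENNReal.ofReal ((2 : ℝ) ^ (j * d : ℝ)) * eLpNorm F 1 volume := by
  have h := eLpNorm_comp_smul (μ := volume) F.continuous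
    (Real.rpow_pos_of_pos two_pos (-(j : ℝ))) 1
  rw [← Real.rpow_mul two_pos.le, finrank_euclideanSpace_fin] at h
  rw [show ⇑(dyadicDilate F j) = fun x => F ((2 : ℝ) ^ (-(j : ℝ)) • x) from rfl, h]
  simp

/-- The product `φ_k F(2^{-j} ·)`, the Fourier transform of the `k`-th dyadic piece of the inverse
transform of `F(2^{-j} ·)`. -/
noncomputable def pieceOfDilate (φ : ℕ → 𝓢(EuclideanSpace ℝ (Fin d), ℝ))
    (F : 𝓢(EuclideanSpace ℝ (Fin d), ℂ)) (k j : ℕ) : 𝓢(EuclideanSpace ℝ (Fin d), ℂ) :=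
  SchwartzMap.smulLeftCLM ℂ (fun x => ((φ k x : ℝ) : ℂ)) (dyadicDilate F j)

lemma pieceOfDilate_apply (φ : ℕ → 𝓢(EuclideanSpace ℝ (Fin d), ℝ))
    (F : 𝓢(EuclideanSpace ℝ (Fin d), ℂ)) (k j : ℕ) (x : EuclideanSpace ℝ (Fin d)) :
    pieceOfDilate φ F k j x = (φ k x : ℂ) * dyadicDilate F j x := by
  rw [pieceOfDilate, SchwartzMap.smulLeftCLM_apply_apply (hasTemperateGrowth_ofReal (φ k)),
    smul_eq_mul]

lemma pieceOfDilate_eq_zero {φ : ℕ → 𝓢(EuclideanSpace ℝ (Fin d), ℝ)}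
    (hφ : IsDyadicResolution φ) {F : 𝓢(EuclideanSpace ℝ (Fin d), ℂ)} (hF : IsAnnular F) {j k : ℕ}
    (h : ¬ (k ≤ j + 1 ∧ j ≤ k + 1)) : pieceOfDilate φ F k j = 0 := by
  ext x
  rw [pieceOfDilate_apply]
  by_contra hne
  obtain ⟨h1, h2⟩ := mul_ne_zero_iff.1 hne
  exact h (hF.close_of_ne_zero hφ h2 (by simpa using h1))

lemma norm_iteratedFDeriv_comp_dilate_le {φ : ℕ → 𝓢(EuclideanSpace ℝ (Fin d), ℝ)} {i : ℕ} {c : ℝ}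
    (hc : ∀ (j : ℕ) (x : EuclideanSpace ℝ (Fin d)),
      (2 : ℝ) ^ (j * i) * ‖iteratedFDeriv ℝ i (φ j) x‖ ≤ c) {j k : ℕ} (h : j ≤ k + 1)
    (x : EuclideanSpace ℝ (Fin d)) :
    ‖iteratedFDeriv ℝ i (fun y => ((φ k ((2 : ℝ) ^ j • y) : ℝ) : ℂ)) x‖ ≤ 2 ^ i * c := by
  have hcd : ContDiff ℝ i (fun y : EuclideanSpace ℝ (Fin d) => φ k ((2 : ℝ) ^ j • y)) :=
    ((φ k).smooth i).comp (contDiff_const_smul _)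
  have h1 : iteratedFDeriv ℝ i (fun y => ((φ k ((2 : ℝ) ^ j • y) : ℝ) : ℂ)) x =
      Complex.ofRealCLM.compContinuousMultilinearMap
        (iteratedFDeriv ℝ i (fun y => φ k ((2 : ℝ) ^ j • y)) x) :=
    Complex.ofRealCLM.iteratedFDeriv_comp_left hcd.contDiffAt le_rfl
  have h2 : ‖iteratedFDeriv ℝ i (fun y => ((φ k ((2 : ℝ) ^ j • y) : ℝ) : ℂ)) x‖ ≤
      ‖iteratedFDeriv ℝ i (fun y => φ k ((2 : ℝ) ^ j • y)) x‖ := by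
    rw [h1]
    refine (ContinuousLinearMap.norm_compContinuousMultilinearMap_le _ _).trans ?_
    rw [Complex.ofRealCLM_norm, one_mul]
  refine h2.trans ?_
  rw [congrFun (iteratedFDeriv_comp_const_smul ((2 : ℝ) ^ j) ((φ k).smooth i)) x, norm_smul,
    Real.norm_of_nonneg (by positivity)]
  have h3 : ((2 : ℝ) ^ j) ^ i ≤ 2 ^ i * 2 ^ (k * i) := by
    rw [← pow_mul, ← pow_add]
    refine pow_le_pow_right₀ one_le_two ?_
    nlinarith
  calc _ ≤ 2 ^ i * 2 ^ (k * i) * ‖iteratedFDeriv ℝ i (φ k) ((2 : ℝ) ^ j • x)‖ := by gcongr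
    _ ≤ _ := by
      rw [mul_assoc]
      gcongr
      exact hc _ _

/-- The pieces of the dilates of an annular function scale like the dilates: after rescaling by `2^j`
they are multiples of `F` by multipliers `φ_k(2^j ·)` with uniformly bounded derivatives. -/
lemma exists_eLpNorm_pieceOfDilate_le {φ : ℕ → 𝓢(EuclideanSpace ℝ (Fin d), ℝ)}
    (hφ : IsDyadicResolution φ) {F : 𝓢(EuclideanSpace ℝ (Fin d), ℂ)} (hF : IsAnnular F)
    (p : ℝ≥0∞) [Fact (1 ≤ p)] :
    ∃ M : ℝ≥0, ∀ k j : ℕ,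
      eLpNorm (𝓕⁻ (pieceOfDilate φ F k j) : 𝓢(EuclideanSpace ℝ (Fin d), ℂ)) p volume ≤
        if k ≤ j + 1 ∧ j ≤ k + 1 then
          ENNReal.ofReal ((2 : ℝ) ^ (j * (d * (1 - p⁻¹.toReal)))) * M else 0 := by
  choose c hc0 hc using hφ.deriv_bound
  obtain ⟨M, hM⟩ := exists_eLpNorm_fourierInv_le F p fun i => 2 ^ i * c i
  refine ⟨M, fun k j => ?_⟩
  split_ifs with h
  · set H := dilate (pieceOfDilate φ F k j) (c := 2 ^ j) (by positivity) with hH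
    have h1 (x) : H x = ((φ k ((2 : ℝ) ^ j • x) : ℝ) : ℂ) * F x := by
      rw [hH, dilate_apply, pieceOfDilate_apply, dyadicDilate_apply, smul_smul,
        Real.rpow_neg two_pos.le, Real.rpow_natCast, inv_mul_cancel₀ (by positivity), one_smul]
    have h2 : pieceOfDilate φ F k j = dyadicDilate H j := by
      ext x
      rw [dyadicDilate_apply, hH, dilate_apply, smul_smul,
        Real.rpow_neg two_pos.le, Real.rpow_natCast, mul_inv_cancel₀ (by positivity), one_smul]
    rw [h2, eLpNorm_fourierInv_dyadicDilate]
    gcongr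
    refine hM (fun x => ((φ k ((2 : ℝ) ^ j • x) : ℝ) : ℂ)) H ?_ ?_ h1
    · exact Complex.ofRealCLM.contDiff.comp (((φ k).smooth _).comp (contDiff_const_smul _))
    · exact fun i x => norm_iteratedFDeriv_comp_dilate_le (hc i) h.2 x
  · rw [pieceOfDilate_eq_zero hφ hF h]
    exact (eLpNorm_fourierInv_zero p).le

lemma two_rpow_mul_le_of_close (α : ℝ) {j k : ℕ} (h : k ≤ j + 1 ∧ j ≤ k + 1) :
    α * k + -(α * j) ≤ |α| := by
  have h1 : |(k : ℝ) - j| ≤ 1 := by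
    have h2 : (k : ℝ) ≤ j + 1 := by exact_mod_cast h.1
    have h3 : (j : ℝ) ≤ k + 1 := by exact_mod_cast h.2
    rw [abs_le]; constructor <;> linarith
  calc α * k + -(α * j) = α * (k - j) := by ring
    _ ≤ |α * (k - j)| := le_abs_self _
    _ = |α| * |(k : ℝ) - j| := abs_mul _ _
    _ ≤ _ := mul_le_of_le_one_right (abs_nonneg _) h1

/-- At most three indices are within distance one of `k`. -/
lemma sum_ite_close_le (k : ℕ) (S : Finset ℕ) (B : ℝ≥0∞) :
    ∑ j ∈ S, (if k ≤ j + 1 ∧ j ≤ k + 1 then B else 0) ≤ 3 * B := by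
  rw [← Finset.sum_filter, Finset.sum_const, nsmul_eq_mul]
  gcongr
  have h1 : S.filter (fun j => k ≤ j + 1 ∧ j ≤ k + 1) ⊆ Finset.Icc (k - 1) (k + 1) := by
    intro j hj
    simp only [Finset.mem_filter, Finset.mem_Icc] at hj ⊢
    omega
  have h2 := Finset.card_le_card h1
  rw [Nat.card_Icc] at h2
  have h3 : (S.filter (fun j => k ≤ j + 1 ∧ j ≤ k + 1)).card ≤ 3 := by omega
  exact_mod_cast h3

lemma fourierInv_sum {ι : Type*} (S : Finset ι) (F : ι → 𝓢(EuclideanSpace ℝ (Fin d), ℂ)) :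
    (𝓕⁻ (∑ j ∈ S, F j) : 𝓢(EuclideanSpace ℝ (Fin d), ℂ)) = ∑ j ∈ S, 𝓕⁻ (F j) :=
  map_sum (fourierInvCLM ℂ 𝓢(EuclideanSpace ℝ (Fin d), ℂ)) F S

lemma eLpNorm_fourierInv_sum_le {ι : Type*} (S : Finset ι)
    (F : ι → 𝓢(EuclideanSpace ℝ (Fin d), ℂ)) {p : ℝ≥0∞} (hp : 1 ≤ p) :
    eLpNorm (𝓕⁻ (∑ j ∈ S, F j) : 𝓢(EuclideanSpace ℝ (Fin d), ℂ)) p volume ≤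
      ∑ j ∈ S, eLpNorm (𝓕⁻ (F j) : 𝓢(EuclideanSpace ℝ (Fin d), ℂ)) p volume := by
  have h : ⇑(𝓕⁻ (∑ j ∈ S, F j) : 𝓢(EuclideanSpace ℝ (Fin d), ℂ)) =
      ∑ j ∈ S, ⇑(𝓕⁻ (F j) : 𝓢(EuclideanSpace ℝ (Fin d), ℂ)) := by
    rw [fourierInv_sum]
    ext x
    simp
  rw [h]
  exact eLpNorm_sum_le (fun j _ => (SchwartzMap.continuous _).aestronglyMeasurable) hp

lemma eLpNorm_fourierInv_smul (a : ℂ) (F : 𝓢(EuclideanSpace ℝ (Fin d), ℂ)) (p : ℝ≥0∞) :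
    eLpNorm (𝓕⁻ (a • F) : 𝓢(EuclideanSpace ℝ (Fin d), ℂ)) p volume =
      ‖a‖ₑ * eLpNorm (𝓕⁻ F : 𝓢(EuclideanSpace ℝ (Fin d), ℂ)) p volume := by
  have h : (𝓕⁻ (a • F) : 𝓢(EuclideanSpace ℝ (Fin d), ℂ)) = a • 𝓕⁻ F :=
    map_smul (fourierInvCLM ℂ 𝓢(EuclideanSpace ℝ (Fin d), ℂ)) a F
  rw [h]
  exact eLpNorm_const_smul a _ p volume

end DyadicBumps

/-! ### High frequencies: the smoothness exponents of the embeddings -/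

section Lacunary

variable {d : ℕ}

/-- A bump function centred at a unit vector of `ℝ^d`, which exists as `d ≥ 1`. -/
lemma exists_isAnnular_schwartzBump (hd : 1 ≤ d) :
    ∃ (x₀ : EuclideanSpace ℝ (Fin d)) (b : ContDiffBump x₀), IsAnnular (schwartzBump b) := by
  let e : EuclideanSpace ℝ (Fin d) := EuclideanSpace.single ⟨0, hd⟩ 1
  have he : ‖e‖ = 1 := by simp [e]
  refine ⟨e, ⟨1 / 8, 1 / 4, by norm_num, by norm_num⟩, fun x hx => ?_⟩
  have h1 : ‖x - e‖ < 1 / 4 := norm_sub_lt_of_schwartzBump_ne_zero hx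
  have h2 := norm_sub_norm_le e x
  have h3 := norm_sub_norm_le x e
  rw [norm_sub_rev] at h2
  constructor <;> linarith

lemma eLpNorm_one_schwartzBump_ne_zero {x₀ : EuclideanSpace ℝ (Fin d)} (b : ContDiffBump x₀) :
    eLpNorm (schwartzBump b) 1 volume ≠ 0 := by
  intro h
  rw [eLpNorm_eq_zero_iff (SchwartzMap.continuous _).aestronglyMeasurable one_ne_zero] at h
  have h1 := congrFun
    ((SchwartzMap.continuous _).ae_eq_iff_eq volume continuous_zero |>.1 h) x₀
  simp [schwartzBump_apply, b.one_of_mem_closedBall (Metric.mem_closedBall_self b.rIn_pos.le)] at h1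

lemma barronNorm_dyadicDilate_le {s : ℝ} (hs : 0 ≤ s) {F : 𝓢(EuclideanSpace ℝ (Fin d), ℂ)}
    (hF : IsAnnular F) (j : ℕ) :
    barronNorm s (𝓕⁻ (dyadicDilate F j : 𝓢'(EuclideanSpace ℝ (Fin d), ℂ))) ≤
      ENNReal.ofReal ((2 : ℝ) ^ (1 + s + (j * s + j * d))) * eLpNorm F 1 volume := by
  rw [barronNorm_fourierInv]
  have h1 (ξ : EuclideanSpace ℝ (Fin d)) :
      ENNReal.ofReal (1 + ‖ξ‖ ^ s) * ‖dyadicDilate F j ξ‖ₑ ≤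
        ENNReal.ofReal ((2 : ℝ) ^ (1 + s + j * s)) * ‖dyadicDilate F j ξ‖ₑ := by
    by_cases hξ : dyadicDilate F j ξ = 0
    · simp [hξ]
    gcongr
    have h2 : ‖ξ‖ ≤ (2 : ℝ) ^ ((1 : ℝ) + j) := by
      have h3 := (hF.norm_bounds hξ).2
      have h4 : (0 : ℝ) < 2 ^ j := by positivity
      rw [Real.rpow_add two_pos, Real.rpow_one, Real.rpow_natCast]
      linarith
    have h5 : ‖ξ‖ ^ s ≤ (2 : ℝ) ^ (s + j * s) := by
      refine (Real.rpow_le_rpow (norm_nonneg _) h2 hs).trans_eq ?_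
      rw [← Real.rpow_mul two_pos.le]
      ring_nf
    have h6 : (1 : ℝ) ≤ (2 : ℝ) ^ (s + j * s) :=
      Real.one_le_rpow one_le_two (by positivity)
    rw [add_assoc, Real.rpow_add two_pos, Real.rpow_one]
    linarith
  calc _ ≤ ∫⁻ ξ, ENNReal.ofReal ((2 : ℝ) ^ (1 + s + j * s)) * ‖dyadicDilate F j ξ‖ₑ :=
        lintegral_mono h1
    _ = ENNReal.ofReal ((2 : ℝ) ^ (1 + s + j * s)) * eLpNorm (dyadicDilate F j) 1 volume := by
        rw [lintegral_const_mul' _ _ ENNReal.ofReal_ne_top, eLpNorm_one_eq_lintegral_enorm]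
    _ = _ := by
        rw [eLpNorm_one_dyadicDilate, ← mul_assoc, ofReal_two_rpow_mul]
        ring_nf

/-- A dilated annular function has at most three nonzero pieces, so its `L^p` norm is controlled
by its Besov norm. -/
lemma eLpNorm_fourierInv_dyadicDilate_le_besovNorm {φ : ℕ → 𝓢(EuclideanSpace ℝ (Fin d), ℝ)}
    (hφ : IsDyadicResolution φ) {F : 𝓢(EuclideanSpace ℝ (Fin d), ℂ)} (hF : IsAnnular F) (α : ℝ)
    (p : ℝ≥0∞) [hp : Fact (1 ≤ p)] {q : ℝ≥0∞} (hq : 1 ≤ q) (j : ℕ) :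
    eLpNorm (𝓕⁻ (dyadicDilate F j) : 𝓢(EuclideanSpace ℝ (Fin d), ℂ)) p volume ≤
      3 * (ENNReal.ofReal ((2 : ℝ) ^ (|α| - α * j)) *
        besovNorm φ α p q (𝓕⁻ (dyadicDilate F j : 𝓢'(EuclideanSpace ℝ (Fin d), ℂ)))) := by
  set B := besovNorm φ α p q (𝓕⁻ (dyadicDilate F j : 𝓢'(EuclideanSpace ℝ (Fin d), ℂ))) with hB
  have h1 : dyadicDilate F j = ∑ k ∈ Finset.range (j + 2), pieceOfDilate φ F k j := by
    ext x
    rw [sum_apply]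
    simp only [pieceOfDilate_apply]
    by_cases hx : dyadicDilate F j x = 0
    · simp [hx]
    · have h2 := hφ.sum_range_eq_one (N := j + 1) (x := x) (by
        have h3 := (hF.norm_bounds hx).2
        have h4 : (0 : ℝ) < 2 ^ j := by positivity
        rw [pow_succ]
        linarith)
      rw [← Finset.sum_mul, ← Complex.ofReal_sum, h2, Complex.ofReal_one, one_mul]
  have h5 (k : ℕ) : eLpNorm (𝓕⁻ (pieceOfDilate φ F k j) : 𝓢(EuclideanSpace ℝ (Fin d), ℂ)) p volume ≤
      if j ≤ k + 1 ∧ k ≤ j + 1 then ENNReal.ofReal ((2 : ℝ) ^ (|α| - α * j)) * B else 0 := by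
    split_ifs with h
    · have h6 := le_besovNorm φ α p hq
        (𝓕⁻ (dyadicDilate F j : 𝓢'(EuclideanSpace ℝ (Fin d), ℂ))) k
      rw [distLpNorm_dyadicPiece_fourierInv (φ k) (pieceOfDilate_apply φ F k j), ← hB] at h6
      calc eLpNorm (𝓕⁻ (pieceOfDilate φ F k j) : 𝓢(EuclideanSpace ℝ (Fin d), ℂ)) p volume
          = ENNReal.ofReal ((2 : ℝ) ^ (-(α * k))) * (ENNReal.ofReal ((2 : ℝ) ^ (α * k)) *
            eLpNorm (𝓕⁻ (pieceOfDilate φ F k j) : 𝓢(EuclideanSpace ℝ (Fin d), ℂ)) p volume) := by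
            rw [← mul_assoc, ofReal_two_rpow_mul]
            simp
        _ ≤ ENNReal.ofReal ((2 : ℝ) ^ (|α| - α * j)) * B := by
            gcongr
            · exact one_le_two
            · have := two_rpow_mul_le_of_close α h
              linarith
    · rw [pieceOfDilate_eq_zero hφ hF (fun h' => h h'.symm)]
      exact (eLpNorm_fourierInv_zero p).le
  calc _ = eLpNorm (𝓕⁻ (∑ k ∈ Finset.range (j + 2), pieceOfDilate φ F k j) :
          𝓢(EuclideanSpace ℝ (Fin d), ℂ)) p volume := by rw [← h1]
    _ ≤ _ := (eLpNorm_fourierInv_sum_le _ _ hp.out).trans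
        ((Finset.sum_le_sum fun k _ => h5 k).trans (sum_ite_close_le j _ _))

/-- If a spectral Barron space embeds into `B^α_{∞,q}` then `α ≤ s`: the Barron norm of a bump at
frequency `2^j` is `∼ 2^{j(s+d)}`, and its norm in `B^α_{∞,q}` is `∼ 2^{j(α+d)}`. -/
theorem le_of_continuouslyEmbeds_top (hd : 1 ≤ d) {φ : ℕ → 𝓢(EuclideanSpace ℝ (Fin d), ℝ)}
    (hφ : IsDyadicResolution φ) {s α : ℝ} (hs : 0 ≤ s) {q : ℝ≥0∞} (hq : 1 ≤ q)
    (h : ContinuouslyEmbeds (barronNorm s) (besovNorm (d := d) φ α ∞ q)) : α ≤ s := by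
  by_contra! hα
  obtain ⟨-, C, hC⟩ := h
  obtain ⟨x₀, b, hF⟩ := exists_isAnnular_schwartzBump hd
  set F := schwartzBump b
  set P := eLpNorm (𝓕⁻ F : 𝓢(EuclideanSpace ℝ (Fin d), ℂ)) ∞ volume with hP
  set A := eLpNorm F 1 volume with hA
  have hAtop : A ≠ ∞ := (F.eLpNorm_lt_top 1 volume).ne
  have key (j : ℕ) : P ≤ 3 * C * A * ENNReal.ofReal ((2 : ℝ) ^ (|α| + 1 + s + j * (s - α))) := by
    have h1 := barronNorm_dyadicDilate_le hs hF j
    rw [← hA] at h1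
    have h2 := hC _ (h1.trans_lt (by finiteness))
    have h3 := eLpNorm_fourierInv_dyadicDilate_le_besovNorm hφ hF α ∞ hq j
    rw [eLpNorm_fourierInv_dyadicDilate, ← hP] at h3
    calc P = ENNReal.ofReal ((2 : ℝ) ^ (-(j * d : ℝ))) *
          (ENNReal.ofReal ((2 : ℝ) ^ (j * (d * (1 - (∞ : ℝ≥0∞)⁻¹.toReal)))) * P) := by
          rw [← mul_assoc, ofReal_two_rpow_mul]
          simp
      _ ≤ ENNReal.ofReal ((2 : ℝ) ^ (-(j * d : ℝ))) *
          (3 * (ENNReal.ofReal ((2 : ℝ) ^ (|α| - α * j)) *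
            (C * (ENNReal.ofReal ((2 : ℝ) ^ (1 + s + (j * s + j * d))) * A)))) := by
          refine mul_le_mul_right (h3.trans ?_) _
          refine mul_le_mul_right (mul_le_mul_right (h2.trans ?_) _) _
          exact mul_le_mul_right h1 _
      _ = 3 * C * A * (ENNReal.ofReal ((2 : ℝ) ^ (-(j * d : ℝ))) *
          ENNReal.ofReal ((2 : ℝ) ^ (|α| - α * j)) *
            ENNReal.ofReal ((2 : ℝ) ^ (1 + s + (j * s + j * d)))) := by ring
      _ = _ := by
          rw [ofReal_two_rpow_mul, ofReal_two_rpow_mul]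
          ring_nf
  have hlim : Tendsto (fun j : ℕ => 3 * C * A *
      ENNReal.ofReal ((2 : ℝ) ^ (|α| + 1 + s + j * (s - α)))) atTop (𝓝 0) := by
    have h1 : Tendsto (fun j : ℕ => (2 : ℝ) ^ (|α| + 1 + s) * ((2 : ℝ) ^ (s - α)) ^ j) atTop
        (𝓝 ((2 : ℝ) ^ (|α| + 1 + s) * 0)) :=
      (tendsto_pow_atTop_nhds_zero_of_lt_one (by positivity)
        (Real.rpow_lt_one_of_one_lt_of_neg one_lt_two (by linarith))).const_mul _
    rw [mul_zero] at h1
    have h2 := ENNReal.Tendsto.const_mul (ENNReal.tendsto_ofReal h1)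
      (Or.inr (by finiteness : 3 * (C : ℝ≥0∞) * A ≠ ∞))
    rw [ENNReal.ofReal_zero, mul_zero] at h2
    refine h2.congr fun j => ?_
    rw [← Real.rpow_natCast, ← Real.rpow_mul two_pos.le, ← Real.rpow_add two_pos]
    ring_nf
  exact eLpNorm_fourierInv_schwartzBump_ne_zero b (p := ∞) (by simp)
    (le_antisymm (ge_of_tendsto' hlim key) zero_le)

/-- The sum `∑_{j<n} 2^{-jβ} F(2^{-j} ξ)` of bumps at the frequencies `2^j`. With
`β = α + d(1 - 1/p)` all terms contribute equally to the norm of `B^α_{p,q}`. -/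
noncomputable def lacunarySum (F : 𝓢(EuclideanSpace ℝ (Fin d), ℂ)) (β : ℝ) (n : ℕ) :
    𝓢(EuclideanSpace ℝ (Fin d), ℂ) :=
  ∑ j ∈ Finset.range n, (((2 : ℝ) ^ (-(j * β)) : ℝ) : ℂ) • dyadicDilate F j

lemma distLpNorm_lacunarySum_le {φ : ℕ → 𝓢(EuclideanSpace ℝ (Fin d), ℝ)}
    (hφ : IsDyadicResolution φ) {F : 𝓢(EuclideanSpace ℝ (Fin d), ℂ)} (hF : IsAnnular F) (α : ℝ)
    (p : ℝ≥0∞) [hp : Fact (1 ≤ p)] :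
    ∃ M : ℝ≥0, ∀ n k : ℕ, ENNReal.ofReal ((2 : ℝ) ^ (α * k)) *
      distLpNorm p (dyadicPiece (φ k) (𝓕⁻ (lacunarySum F (α + d * (1 - p⁻¹.toReal)) n :
        𝓢'(EuclideanSpace ℝ (Fin d), ℂ)))) ≤ if k ≤ n then (M : ℝ≥0∞) else 0 := by
  obtain ⟨M, hM⟩ := exists_eLpNorm_pieceOfDilate_le hφ hF p
  set β := α + d * (1 - p⁻¹.toReal) with hβ
  refine ⟨3 * (Real.toNNReal ((2 : ℝ) ^ |α|) * M), fun n k => ?_⟩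
  have h1 (x) : (∑ j ∈ Finset.range n, (((2 : ℝ) ^ (-(j * β)) : ℝ) : ℂ) • pieceOfDilate φ F k j :
      𝓢(EuclideanSpace ℝ (Fin d), ℂ)) x = (φ k x : ℂ) * lacunarySum F β n x := by
    rw [lacunarySum, sum_apply, sum_apply, Finset.mul_sum]
    refine Finset.sum_congr rfl fun j _ => ?_
    simp only [smul_apply, pieceOfDilate_apply, smul_eq_mul]
    ring
  rw [distLpNorm_dyadicPiece_fourierInv (φ k) h1]
  have h2 (j : ℕ) : ENNReal.ofReal ((2 : ℝ) ^ (α * k)) *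
      eLpNorm (𝓕⁻ ((((2 : ℝ) ^ (-(j * β)) : ℝ) : ℂ) • pieceOfDilate φ F k j) :
        𝓢(EuclideanSpace ℝ (Fin d), ℂ)) p volume ≤
      if k ≤ j + 1 ∧ j ≤ k + 1 then ENNReal.ofReal ((2 : ℝ) ^ |α|) * M else 0 := by
    rw [eLpNorm_fourierInv_smul]
    refine (mul_le_mul_right (mul_le_mul_right (hM k j) _) _).trans ?_
    split_ifs with h
    · have e1 : ‖(((2 : ℝ) ^ (-(j * β)) : ℝ) : ℂ)‖ₑ = ENNReal.ofReal ((2 : ℝ) ^ (-(j * β))) := by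
        rw [← ofReal_norm, Complex.norm_real, Real.norm_of_nonneg (by positivity)]
      rw [e1, ← mul_assoc, ← mul_assoc, ofReal_two_rpow_mul, ofReal_two_rpow_mul]
      gcongr
      · exact one_le_two
      · refine le_trans (le_of_eq ?_) (two_rpow_mul_le_of_close α h)
        rw [hβ]; ring
    · simp
  calc _ ≤ ENNReal.ofReal ((2 : ℝ) ^ (α * k)) * ∑ j ∈ Finset.range n,
        eLpNorm (𝓕⁻ ((((2 : ℝ) ^ (-(j * β)) : ℝ) : ℂ) • pieceOfDilate φ F k j) :
          𝓢(EuclideanSpace ℝ (Fin d), ℂ)) p volume := by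
        gcongr
        exact eLpNorm_fourierInv_sum_le _ _ hp.out
    _ ≤ ∑ j ∈ Finset.range n, (if k ≤ j + 1 ∧ j ≤ k + 1 then
          ENNReal.ofReal ((2 : ℝ) ^ |α|) * M else 0) := by
        rw [Finset.mul_sum]
        exact Finset.sum_le_sum fun j _ => h2 j
    _ ≤ _ := by
        split_ifs with h
        · refine (sum_ite_close_le k _ _).trans_eq ?_
          simp [ENNReal.ofReal]
        · refine (Finset.sum_eq_zero fun j hj => if_neg ?_).le
          rw [Finset.mem_range] at hj
          omega

/-- A Besov norm with at most `n + 1` nonzero pieces. -/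
lemma besovNorm_le_of_pieces {φ : ℕ → 𝓢(EuclideanSpace ℝ (Fin d), ℝ)} {α : ℝ} {p : ℝ≥0∞}
    [Fact (1 ≤ p)] {q : ℝ≥0∞} (hq : 1 ≤ q) {f : 𝓢'(EuclideanSpace ℝ (Fin d), ℂ)} {n : ℕ}
    {M : ℝ≥0∞} (h : ∀ k : ℕ, ENNReal.ofReal ((2 : ℝ) ^ (α * k)) *
      distLpNorm p (dyadicPiece (φ k) f) ≤ if k ≤ n then M else 0) :
    besovNorm φ α p q f ≤ ((n + 1 : ℕ) : ℝ≥0∞) ^ q⁻¹.toReal * M := by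
  unfold besovNorm
  split_ifs with hqt
  · refine iSup_le fun k => (h k).trans ?_
    simp only [hqt, ENNReal.inv_top, ENNReal.toReal_zero, ENNReal.rpow_zero, one_mul]
    split_ifs <;> simp
  · have hq0 : 0 < q.toReal := ENNReal.toReal_pos (by positivity) hqt
    have h1 (k : ℕ) : ENNReal.ofReal ((2 : ℝ) ^ (α * q.toReal * k)) *
        distLpNorm p (dyadicPiece (φ k) f) ^ q.toReal ≤
        if k ∈ Finset.range (n + 1) then M ^ q.toReal else 0 := by
      have e1 : ENNReal.ofReal ((2 : ℝ) ^ (α * q.toReal * k)) =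
          ENNReal.ofReal ((2 : ℝ) ^ (α * k)) ^ q.toReal := by
        rw [ENNReal.ofReal_rpow_of_nonneg (by positivity) hq0.le, ← Real.rpow_mul two_pos.le]
        ring_nf
      rw [e1, ← ENNReal.mul_rpow_of_nonneg _ _ hq0.le]
      refine (ENNReal.rpow_le_rpow (h k) hq0.le).trans_eq ?_
      simp only [Finset.mem_range, Nat.lt_succ_iff]
      split_ifs <;> simp [hq0]
    have h2 : (∑' k : ℕ, ENNReal.ofReal ((2 : ℝ) ^ (α * q.toReal * k)) *
        distLpNorm p (dyadicPiece (φ k) f) ^ q.toReal) ≤ ((n + 1 : ℕ) : ℝ≥0∞) * M ^ q.toReal := by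
      refine (ENNReal.tsum_le_tsum h1).trans_eq ?_
      rw [tsum_eq_sum (s := Finset.range (n + 1)) (fun k hk => if_neg hk),
        Finset.sum_congr rfl (fun k hk => if_pos hk), Finset.sum_const, Finset.card_range,
        nsmul_eq_mul]
    refine (ENNReal.rpow_le_rpow h2 (by positivity)).trans_eq ?_
    rw [ENNReal.mul_rpow_of_nonneg _ _ (by positivity), ← ENNReal.rpow_mul,
      mul_one_div_cancel hq0.ne', ENNReal.rpow_one, ENNReal.toReal_inv, one_div]

/-- The terms of a lacunary sum are nonnegative functions, so their Barron norms add up. -/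
lemma le_barronNorm_lacunarySum {s : ℝ} (hs : 0 ≤ s) {x₀ : EuclideanSpace ℝ (Fin d)}
    {b : ContDiffBump x₀} (hF : IsAnnular (schwartzBump b)) (β : ℝ) (n : ℕ) :
    (∑ j ∈ Finset.range n, ENNReal.ofReal ((2 : ℝ) ^ (j * (s + d - β)))) *
        (ENNReal.ofReal ((2 : ℝ) ^ (-s)) * eLpNorm (schwartzBump b) 1 volume) ≤
      barronNorm s (𝓕⁻ (lacunarySum (schwartzBump b) β n :
        𝓢'(EuclideanSpace ℝ (Fin d), ℂ))) := by
  set F := schwartzBump b with hFdef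
  have h1 (ξ : EuclideanSpace ℝ (Fin d)) : ‖lacunarySum F β n ξ‖ₑ =
      ∑ j ∈ Finset.range n, ENNReal.ofReal ((2 : ℝ) ^ (-(j * β))) * ‖dyadicDilate F j ξ‖ₑ := by
    have e1 : lacunarySum F β n ξ = ((∑ j ∈ Finset.range n, (2 : ℝ) ^ (-(j * β)) *
        b ((2 : ℝ) ^ (-(j : ℝ)) • ξ) : ℝ) : ℂ) := by
      rw [lacunarySum, sum_apply, Complex.ofReal_sum]
      refine Finset.sum_congr rfl fun j _ => ?_
      rw [smul_apply, dyadicDilate_apply, hFdef, schwartzBump_apply, smul_eq_mul,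
        Complex.ofReal_mul]
    have hnn (j : ℕ) : 0 ≤ (2 : ℝ) ^ (-(j * β)) * b ((2 : ℝ) ^ (-(j : ℝ)) • ξ) :=
      mul_nonneg (by positivity) b.nonneg
    rw [e1, ← ofReal_norm, Complex.norm_real, Real.norm_of_nonneg (Finset.sum_nonneg fun j _ => hnn j),
      ENNReal.ofReal_sum_of_nonneg fun j _ => hnn j]
    refine Finset.sum_congr rfl fun j _ => ?_
    rw [ENNReal.ofReal_mul (by positivity), dyadicDilate_apply, hFdef, schwartzBump_apply,
      ← ofReal_norm, Complex.norm_real, Real.norm_of_nonneg b.nonneg]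
  have h2 (j : ℕ) (ξ : EuclideanSpace ℝ (Fin d)) :
      ENNReal.ofReal ((2 : ℝ) ^ (j * s + -s)) * ‖dyadicDilate F j ξ‖ₑ ≤
        ENNReal.ofReal (1 + ‖ξ‖ ^ s) * ‖dyadicDilate F j ξ‖ₑ := by
    by_cases hξ : dyadicDilate F j ξ = 0
    · simp [hξ]
    gcongr
    have h3 := (hF.norm_bounds hξ).1
    have h4 : (2 : ℝ) ^ ((j : ℝ) + -1) ≤ ‖ξ‖ := by
      have h5 : (0 : ℝ) < 2 ^ j := by positivity
      rw [Real.rpow_add two_pos, Real.rpow_neg_one, Real.rpow_natCast]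
      linarith
    have h6 := Real.rpow_le_rpow (by positivity) h4 hs
    rw [← Real.rpow_mul two_pos.le] at h6
    have h7 : (j : ℝ) * s + -s = ((j : ℝ) + -1) * s := by ring
    rw [h7]
    linarith
  rw [barronNorm_fourierInv]
  calc _ = ∑ j ∈ Finset.range n, ∫⁻ ξ, ENNReal.ofReal ((2 : ℝ) ^ (-(j * β))) *
          (ENNReal.ofReal ((2 : ℝ) ^ (j * s + -s)) * ‖dyadicDilate F j ξ‖ₑ) := by
        rw [Finset.sum_mul]
        refine Finset.sum_congr rfl fun j _ => ?_
        rw [lintegral_const_mul' _ _ ENNReal.ofReal_ne_top,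
          lintegral_const_mul' _ _ ENNReal.ofReal_ne_top, ← eLpNorm_one_eq_lintegral_enorm,
          eLpNorm_one_dyadicDilate, ← mul_assoc, ← mul_assoc, ← mul_assoc,
          ofReal_two_rpow_mul, ofReal_two_rpow_mul, ofReal_two_rpow_mul]
        ring_nf
    _ = ∫⁻ ξ, ∑ j ∈ Finset.range n, ENNReal.ofReal ((2 : ℝ) ^ (-(j * β))) *
          (ENNReal.ofReal ((2 : ℝ) ^ (j * s + -s)) * ‖dyadicDilate F j ξ‖ₑ) := by
        refine (lintegral_finsetSum _ fun j _ => ?_).symm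
        exact ((dyadicDilate F j).continuous.measurable.enorm.const_mul _).const_mul _
    _ ≤ _ := by
        refine lintegral_mono fun ξ => ?_
        rw [h1, Finset.mul_sum]
        refine Finset.sum_le_sum fun j _ => ?_
        rw [mul_left_comm (ENNReal.ofReal (1 + ‖ξ‖ ^ s))]
        exact mul_le_mul_right (h2 j ξ) _

/-- Growth comparison: a sum of `n` powers `2^{jσ}` is bounded by `K (n + 1)^θ`, `θ ≤ 1`, only if
`σ < 0`, or `σ = 0` and `θ = 1`. -/
lemma exponents_of_sum_two_rpow_le {σ θ K : ℝ} (hθ0 : 0 ≤ θ) (hθ : θ ≤ 1)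
    (h : ∀ n : ℕ, ∑ j ∈ Finset.range n, (2 : ℝ) ^ (j * σ) ≤ K * ((n : ℝ) + 1) ^ θ) :
    σ < 0 ∨ σ = 0 ∧ θ = 1 := by
  rcases lt_or_ge σ 0 with hσ | hσ
  · exact Or.inl hσ
  right
  have h1 : θ = 1 := by
    by_contra hne
    have hlt : 0 < 1 - θ := sub_pos.2 (lt_of_le_of_ne hθ hne)
    have hn (n : ℕ) : ((n : ℝ) + 1) ^ (1 - θ) ≤ K + 1 := by
      have hpos : (0 : ℝ) < (n : ℝ) + 1 := by positivity
      have h2 : (n : ℝ) ≤ ∑ j ∈ Finset.range n, (2 : ℝ) ^ (j * σ) := by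
        calc (n : ℝ) = ∑ j ∈ Finset.range n, (1 : ℝ) := by simp
          _ ≤ _ := Finset.sum_le_sum fun j _ => Real.one_le_rpow one_le_two (by positivity)
      have h3 : (1 : ℝ) ≤ ((n : ℝ) + 1) ^ θ :=
        Real.one_le_rpow (by linarith [Nat.cast_nonneg (α := ℝ) n]) hθ0
      have h4 := h2.trans (h n)
      rw [Real.rpow_sub hpos, Real.rpow_one, div_le_iff₀ (by positivity)]
      linarith
    have hlim : Tendsto (fun n : ℕ => ((n : ℝ) + 1) ^ (1 - θ)) atTop atTop :=
      (tendsto_rpow_atTop hlt).comp (tendsto_natCast_atTop_atTop.atTop_add tendsto_const_nhds)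
    obtain ⟨n, h5⟩ := (hlim.eventually_gt_atTop (K + 1)).exists
    exact absurd (hn n) (not_le.2 h5)
  refine ⟨le_antisymm (not_lt.1 fun hpos => ?_) hσ, h1⟩
  subst h1
  have hr : 1 < (2 : ℝ) ^ σ := Real.one_lt_rpow one_lt_two hpos
  have hn (n : ℕ) : 1 ≤ K * ((n : ℝ) ^ 1 / ((2 : ℝ) ^ σ) ^ n) +
      2 * K * ((n : ℝ) ^ 0 / ((2 : ℝ) ^ σ) ^ n) := by
    have h2 : ((2 : ℝ) ^ σ) ^ n ≤ ∑ j ∈ Finset.range (n + 1), (2 : ℝ) ^ (j * σ) := by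
      rw [← Real.rpow_natCast, ← Real.rpow_mul two_pos.le, mul_comm σ]
      exact Finset.single_le_sum (f := fun j : ℕ => (2 : ℝ) ^ (j * σ))
        (fun j _ => by positivity) (Finset.self_mem_range_succ n)
    have h3 := h2.trans (h (n + 1))
    rw [Real.rpow_one] at h3
    push_cast at h3
    have h4 : 0 < ((2 : ℝ) ^ σ) ^ n := by positivity
    calc (1 : ℝ) ≤ K * ((n : ℝ) + 1 + 1) / ((2 : ℝ) ^ σ) ^ n := by
          rwa [le_div_iff₀ h4, one_mul]
      _ = _ := by ring
  have hlim := ((tendsto_pow_const_div_const_pow_of_one_lt 1 hr).const_mul K).add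
    ((tendsto_pow_const_div_const_pow_of_one_lt 0 hr).const_mul (2 * K))
  have := ge_of_tendsto' hlim hn
  norm_num at this

/-- If `B^α_{p,q}` embeds into a spectral Barron space, then `α > s + d/p`, or `α = s + d/p` and
`q = 1`: the lacunary sum of `n` bumps has Besov norm at most of order `n^{1/q}`, and Barron norm at
least of order `∑_{j<n} 2^{j(s + d/p - α)}`. -/
theorem exponents_of_continuouslyEmbeds (hd : 1 ≤ d) {φ : ℕ → 𝓢(EuclideanSpace ℝ (Fin d), ℝ)}
    (hφ : IsDyadicResolution φ) {s α : ℝ} (hs : 0 ≤ s) {p q : ℝ≥0∞} [Fact (1 ≤ p)] (hq : 1 ≤ q)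
    (h : ContinuouslyEmbeds (besovNorm φ α p q) (barronNorm s)) :
    s + d * p⁻¹.toReal < α ∨ (s + d * p⁻¹.toReal = α ∧ q = 1) := by
  obtain ⟨-, C, hC⟩ := h
  obtain ⟨x₀, b, hF⟩ := exists_isAnnular_schwartzBump hd
  obtain ⟨M, hM⟩ := distLpNorm_lacunarySum_le hφ hF α p
  set β := α + d * (1 - p⁻¹.toReal) with hβ
  set F := schwartzBump b with hFdef
  set A := ENNReal.ofReal ((2 : ℝ) ^ (-s)) * eLpNorm F 1 volume with hA
  have hA0 : 0 < A.toReal := by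
    refine ENNReal.toReal_pos (mul_ne_zero ?_ (eLpNorm_one_schwartzBump_ne_zero b)) ?_
    · exact (ENNReal.ofReal_pos.2 (by positivity)).ne'
    · exact ENNReal.mul_ne_top ENNReal.ofReal_ne_top (F.eLpNorm_lt_top 1 volume).ne
  clear_value A
  have hqi : q⁻¹ ≤ 1 := ENNReal.inv_le_one.2 hq
  have hθ : q⁻¹.toReal ≤ 1 := by
    simpa using ENNReal.toReal_mono ENNReal.one_ne_top hqi
  have key (n : ℕ) : ∑ j ∈ Finset.range n, (2 : ℝ) ^ (j * (s + d - β)) ≤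
      C * M / A.toReal * ((n : ℝ) + 1) ^ q⁻¹.toReal := by
    have h1 := besovNorm_le_of_pieces hq (hM n)
    have hfin : (((n + 1 : ℕ) : ℝ≥0∞) ^ q⁻¹.toReal * M) ≠ ∞ :=
      ENNReal.mul_ne_top (ENNReal.rpow_ne_top_of_nonneg ENNReal.toReal_nonneg
        (ENNReal.natCast_ne_top _)) ENNReal.coe_ne_top
    have h2 := (le_barronNorm_lacunarySum hs hF β n).trans
      ((hC _ (h1.trans_lt hfin.lt_top)).trans (mul_le_mul_right h1 _))
    have h3 := ENNReal.toReal_mono (ENNReal.mul_ne_top ENNReal.coe_ne_top hfin) h2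
    rw [← hFdef, ← hA, ENNReal.toReal_mul, ENNReal.toReal_mul, ENNReal.toReal_mul,
      ENNReal.toReal_sum (fun _ _ => ENNReal.ofReal_ne_top), ← ENNReal.toReal_rpow] at h3
    simp only [ENNReal.toReal_ofReal (Real.rpow_nonneg two_pos.le _), ENNReal.coe_toReal,
      ENNReal.toReal_natCast] at h3
    rw [div_mul_eq_mul_div, le_div_iff₀ hA0]
    push_cast at h3
    linarith
  have he : s + d - β = s + d * p⁻¹.toReal - α := by rw [hβ]; ring
  rcases exponents_of_sum_two_rpow_le ENNReal.toReal_nonneg hθ key with h1 | ⟨h1, h2⟩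
  · left; linarith
  · right
    refine ⟨by linarith, ?_⟩
    rw [ENNReal.toReal_eq_one_iff, ENNReal.inv_eq_one] at h2
    exact h2

end Lacunary

/-! ### The constant in high dimension -/

lemma unitBallVolume_eq {d : ℕ} (hd : 1 ≤ d) :
    unitBallVolume d = √Real.pi ^ d / Real.Gamma (d / 2 + 1) := by
  have : Nonempty (Fin d) := ⟨⟨0, hd⟩⟩
  have hG : 0 < Real.Gamma ((d : ℝ) / 2 + 1) := Real.Gamma_pos_of_pos (by positivity)
  rw [unitBallVolume, Measure.real, EuclideanSpace.volume_ball]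
  simp only [ENNReal.ofReal_one, one_pow, one_mul, Fintype.card_fin]
  rw [ENNReal.toReal_ofReal (by positivity)]

/-- The restriction to `d ≥ 2` keeps the arguments in `[2, ∞)`, where `Γ` increases. -/
lemma factorial_le_Gamma (d : ℕ) (hd : 2 ≤ d) :
    ((d / 2).factorial : ℝ) ≤ Real.Gamma (d / 2 + 1) := by
  rw [← Real.Gamma_nat_eq_factorial]
  have h1 : 1 ≤ d / 2 := by omega
  have h2 : (1 : ℝ) ≤ ((d / 2 : ℕ) : ℝ) := by exact_mod_cast h1
  have h3 : ((d / 2 : ℕ) : ℝ) ≤ (d : ℝ) / 2 := by exact_mod_cast Nat.cast_div_le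
  refine Real.Gamma_strictMonoOn_Ici.monotoneOn ?_ ?_ ?_
  · simp only [Set.mem_Ici]; linarith
  · simp only [Set.mem_Ici]; linarith
  · linarith

/-- The factor `2^{d/2} √ν_d` tends to zero, as `ν_d` decays like `π^{d/2} / Γ(d/2 + 1)`. -/
lemma tendsto_two_rpow_mul_sqrt_unitBallVolume (s : ℝ) :
    Tendsto (fun d : ℕ => (2 : ℝ) ^ (s + 1 + d / 2 : ℝ) * √(unitBallVolume d)) atTop (𝓝 0) := by
  have hlim : Tendsto (fun d : ℕ => (2 : ℝ) ^ (s + 1) *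
      √(4 * ((16 : ℝ) ^ (d / 2) / ((d / 2).factorial : ℝ)))) atTop (𝓝 0) := by
    have h1 : Tendsto (fun d : ℕ => (16 : ℝ) ^ (d / 2) / ((d / 2).factorial : ℝ)) atTop (𝓝 0) :=
      (FloorSemiring.tendsto_pow_div_factorial_atTop (16 : ℝ)).comp
        (Nat.tendsto_div_const_atTop two_ne_zero)
    have h2 := ((h1.const_mul 4).sqrt).const_mul ((2 : ℝ) ^ (s + 1))
    simpa using h2
  refine squeeze_zero' (.of_forall fun d => by positivity) ?_ hlim
  filter_upwards [eventually_ge_atTop 2] with d hd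
  have hG := factorial_le_Gamma d hd
  have hf : (0 : ℝ) < ((d / 2).factorial : ℝ) := by positivity
  have hpi : √Real.pi ≤ 2 := by
    rw [Real.sqrt_le_left two_pos.le]
    linarith [Real.pi_le_four]
  have e1 : (2 : ℝ) ^ ((d : ℝ) / 2) = √((2 : ℝ) ^ d) := by
    rw [Real.sqrt_eq_rpow, ← Real.rpow_natCast, ← Real.rpow_mul two_pos.le]
    ring_nf
  rw [Real.rpow_add two_pos, mul_assoc, e1, ← Real.sqrt_mul (by positivity),
    unitBallVolume_eq (by omega)]
  refine mul_le_mul_of_nonneg_left (Real.sqrt_le_sqrt ?_) (by positivity)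
  have h4 : (4 : ℝ) ^ d ≤ 4 * 16 ^ (d / 2) := by
    have h5 : d ≤ 2 * (d / 2) + 1 := by omega
    calc (4 : ℝ) ^ d ≤ 4 ^ (2 * (d / 2) + 1) := pow_le_pow_right₀ (by norm_num) h5
      _ = 4 * 16 ^ (d / 2) := by
        rw [pow_succ, pow_mul]; norm_num; ring
  calc (2 : ℝ) ^ d * (√Real.pi ^ d / Real.Gamma (d / 2 + 1))
      = (2 * √Real.pi) ^ d / Real.Gamma (d / 2 + 1) := by rw [mul_pow]; ring
    _ ≤ 4 ^ d / ((d / 2).factorial : ℝ) := by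
        gcongr
        linarith
    _ ≤ 4 * 16 ^ (d / 2) / ((d / 2).factorial : ℝ) := by gcongr
    _ = _ := by ring

/-! ### The embeddings and their optimality -/

theorem theorem2p6 (s : ℝ) (hs : 0 ≤ s) :
    (∀ d : ℕ, 1 ≤ d → ∀ φ : ℕ → 𝓢(EuclideanSpace ℝ (Fin d), ℝ), IsDyadicResolution φ →
      (ContinuouslyEmbeds (besovNorm φ (s + d / 2) 2 1) (barronNorm s) ∧
        ContinuouslyEmbeds (barronNorm s) (besovNorm φ s ∞ 1) ∧
        ∀ f : 𝓢'(EuclideanSpace ℝ (Fin d), ℂ),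
          ENNReal.ofReal ((2 : ℝ) ^ (-s)) * besovNorm φ s ∞ 1 f ≤ barronNorm s f ∧
          barronNorm s f ≤
            ENNReal.ofReal ((2 : ℝ) ^ (s + 1 + d / 2 : ℝ) * √(unitBallVolume d)) *
              besovNorm φ (s + d / 2) 2 1 f) ∧
      (∀ (α : ℝ) (p q : ℝ≥0∞) [Fact (1 ≤ p)], 1 ≤ q →
        (ContinuouslyEmbeds (besovNorm φ α p q) (barronNorm s) ↔
          ContinuouslyEmbeds (besovNorm φ α p q) (besovNorm φ (s + d / 2) 2 1)) ∧
        (ContinuouslyEmbeds (barronNorm s) (besovNorm φ α p q) ↔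
          ContinuouslyEmbeds (besovNorm φ s ∞ 1) (besovNorm φ α p q)))) ∧
    Tendsto (fun d : ℕ => (2 : ℝ) ^ (s + 1 + d / 2 : ℝ) * √(unitBallVolume d)) atTop (𝓝 0) := by
  refine ⟨fun d hd φ hφ => ?_, tendsto_two_rpow_mul_sqrt_unitBallVolume s⟩
  have hlower (f : 𝓢'(EuclideanSpace ℝ (Fin d), ℂ)) := besovNorm_top_one_le_barronNorm hφ hs f
  have hupper (f : 𝓢'(EuclideanSpace ℝ (Fin d), ℂ)) := barronNorm_le_besovNorm hφ hs f
  have hBesovBarron : ContinuouslyEmbeds (besovNorm φ (s + d / 2) 2 1) (barronNorm s) :=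
    .of_le (Real.toNNReal _) fun f _ => hupper f
  have hBarronBesov : ContinuouslyEmbeds (barronNorm s) (besovNorm φ s ∞ 1) := by
    refine .of_le (Real.toNNReal ((2 : ℝ) ^ s)) fun f _ => ?_
    calc besovNorm φ s ∞ 1 f
        = ENNReal.ofReal ((2 : ℝ) ^ s) *
            (ENNReal.ofReal ((2 : ℝ) ^ (-s)) * besovNorm φ s ∞ 1 f) := by
          rw [← mul_assoc, ofReal_two_rpow_mul]
          simp
      _ ≤ ENNReal.ofReal ((2 : ℝ) ^ s) * barronNorm s f := mul_le_mul_right (hlower f) _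
  refine ⟨⟨hBesovBarron, hBarronBesov, fun f => ⟨hlower f, hupper f⟩⟩, ?_⟩
  intro α p q _ hq
  refine ⟨⟨fun h => ?_, fun h => h.trans hBesovBarron⟩, ⟨fun h => ?_, fun h => hBarronBesov.trans h⟩⟩
  · exact continuouslyEmbeds_besovNorm_two_one hφ (le_two_of_continuouslyEmbeds hd hφ hq h) hq
      (exponents_of_continuouslyEmbeds hd hφ hs hq h)
  · obtain rfl := eq_top_of_continuouslyEmbeds hd hφ hs hq h
    refine .of_le 1 fun f _ => ?_
    rw [ENNReal.coe_one, one_mul]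
    exact besovNorm_le_besovNorm_one φ (le_of_continuouslyEmbeds_top hd hφ hs hq h) ∞ hq f
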